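/- Setting. Fix integers $0\le t<n$, agents $\mathit{Agt}=\{1,\dots,n\}$ and values $\{0,1\}$. A crash adversary with at most $t$ failures is a map $\mathcal F:\mathbb N\times \mathit{Agt}\times \mathit{Agt}\to\{\top,\bot\}$, where $\mathcal F(k,i,j)=\top$ means that in round $k+1$ (between times $k$ and $k+1$) the message from $i$ to $j$ is delivered, such that: $\mathcal F(k,i,j)=\bot$ implies $\mathcal F(k,i,i)=\bot$ (messages are lost only once the sender has crashed or is crashing in that round); $\mathcal F(k,i,i)=\bot$ implies $\mathcal F(k',i,j)=\bot$ for all $k'>k$ and all $j$; and at most $t$ agents $i$ have $\mathcal F(k,i,j)=\bot$ for some $k,j$. Agent $i$ enters the state $\mathit{crashed}$ for good at the end of the first round $k+1$ with $\mathcal F(k,i,i)=\bot$. The SendWaste exchange. The local state of an agent is $\mathit{crashed}$ or a tuple $\langle W,h,d,m,v\rangle$ with $W\subseteq\{0,1\}$, $h\in\mathbb N$, $d\in\mathbb Z$, time $m$ and initial value $v$. The initial states are $\langle\{v\},0,0,0,v\rangle$ with $v\in\{0,1\}$. In each round a noncrashed agent sends $(W,d)$ to every agent, itself included. An agent that does not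 crash in round $m+1$ moves from $\langle W,h,d,m,v\rangle$ to $\langle W',h',d',m+1,v\rangle$, where $W'$ is the union of the sets received, $h'$ is the number of agents from which no message was received in this round, and $d'$ is the maximum of $d$, all estimates received, and $h'-(m+1)$. A decision protocol $P$ assigns to each agent and local state one of the actions $\mathtt{decide}(0),\mathtt{decide}(1),\mathtt{noop}$; actions influence neither messages nor states. A run $r$ is given by an adversary and initial values, $r_i(m)$ is the local state of $i$ at time $m$, and $\mathcal I$ is the system of all runs. Let $\mathcal N(r,m)=\{i: r_i(m)\ne \mathit{crashed}\}$ and let $d_{\mathcal N}(r,m)$ be the maximum of the $d$-components of $r_i(m)$ over $i\in\mathcal N(r,m)$. Knowledge. $K_i\varphi$ holds at $(r,m)$ if $\varphi$ holds at all points $(r',m')$ of $\mathcal I$ with $r'_i(m')=r_i(m)$; $E_{\mathcal N}\varphi$ holds at $(r,m)$ if $K_i\varphi$ does for all $i\in\mathcal N(r,m)$; $C_{\mathcal N}\varphi$ holds if $E_{\mathcal N}^k\varphi$ does for all $k\ge1$. The proposition $\exists v$ says that some agent has initial value $v$. Protocols. $P$ decides $v$ for $i$ at $(r,m)$ if $P_i(r_i(m))=\mathtt{decide}(v)$.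 $P$ is an SBA protocol if in every run: any two decisions, at whatever times, made by agents that are nonfailed when they decide are for the same value; a value decided by a nonfailed agent is the initial value of some agent; and if some nonfailed agent decides at time $m$, then all agents of $\mathcal N(r,m)$ decide at time $m$. $P$ is an optimum SBA protocol if it is an SBA protocol and, for every SBA protocol $P'$ for the same exchange and $t$, whenever $i\in\mathcal N(r,m)$ decides some value at $(r,m)$ under $P'$, then $i$ decides some value under $P$ at time $m$ of the run with the same adversary and initial values. $P^{\mathrm{send}}$ is the protocol in which an agent in state $\langle W,h,d,m,v\rangle$ decides $\min W$ if $m\ge\min\{t+1,n-1\}-d$, and performs $\mathtt{noop}$ otherwise. Theorem. (1) For every run $r$ of SendWaste, every time $m$ and every agent $i$ that is nonfailed at $(r,m)$ (such an $i$ always exists), at least one of $C_{\mathcal N}(\exists 0)$, $C_{\mathcal N}(\exists 1)$ holds at $(r,m)$ if and only if $m\ge\min\{t+1,n-1\}-d_{\mathcal N}(r,m)$. (2) $P^{\mathrm{send}}$ is an optimum SBA protocol for the SendWaste exchange, and in every run every agent eventually decides or fails under $P^{\mathrm{send}}$. -/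

import Mathlib

namespace SBA

/-- The set `{0, 1}` of values. -/
abbrev Value : Type := Fin 2

/-- The actions available to an agent: decide a value, or do nothing. -/
inductive Action : Type where
  | decide (v : Value) : Action
  | noop : Action

/-- Failure patterns. `F k i j = true` says that in the round between time `k` and time `k + 1`
the message of agent `i` to agent `j` (if any) is delivered. Agent `i` crashes in that round,
or has crashed before, iff `F k i i = false`. -/
abbrev FailurePattern (n : ℕ) : Type := ℕ → Fin n → Fin n → Bool

/-- The crash failure model with at most `t` failures: messages are lost only from the round in
which the sender crashes, nothing is sent after a crash, and at most `t` agents crash. -/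
def Crash (n t : ℕ) : Set (FailurePattern n) :=
  {F | (∀ k i j, F k i j = false → F k i i = false) ∧
       (∀ k i, F k i i = false → ∀ k', k < k' → ∀ j, F k' i j = false) ∧
       {i : Fin n | ∃ k j, F k i j = false}.ncard ≤ t}

/-- An information exchange protocol for `n` agents under crash failures. `none` is the absent
message. -/
structure InfoExchange (n : ℕ) where
  /-- local states -/
  L : Type
  /-- messages -/
  M : Type
  /-- initial local states of each agent -/
  I : Fin n → Set L
  /-- the initial value recorded in an initial local state (irrelevant outside `I`) -/
  init : Fin n → L → Value
  /-- the time on the clock of an agent -/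
  time : Fin n → L → ℕ
  /-- the special state of an agent that has crashed -/
  crashed : L
  /-- message selection: `μ i s a j` is the message that `i` sends to `j` -/
  μ : Fin n → L → Action → Fin n → Option M
  /-- state update -/
  δ : Fin n → L → FailurePattern n → Action → (Fin n → Option M) → L
  init_bijOn : ∀ i, Set.BijOn (init i) (I i) Set.univ
  δ_crash : ∀ i s F a msgs, F (time i s) i i = false → δ i s F a msgs = crashed
  δ_crashed : ∀ i F a msgs, δ i crashed F a msgs = crashed

variable {n : ℕ}

/-- A decision protocol: a map from local states to actions for each agent. -/
abbrev DecisionProtocol (E : InfoExchange n) : Type := Fin n → E.L → Action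

/-- A global state: a state of the environment and a local state for each agent. -/
structure GlobalState (E : InfoExchange n) where
  env : FailurePattern n
  loc : Fin n → E.L

abbrev Run (E : InfoExchange n) : Type := ℕ → GlobalState E

/-- The runs generated by the decision protocol `P` and the information exchange `E` in the crash
failure model with at most `t` failures. -/
structure IsRun (E : InfoExchange n) (t : ℕ) (P : DecisionProtocol E) (r : Run E) : Prop where
  env_mem : (r 0).env ∈ Crash n t
  env_const : ∀ m, (r m).env = (r 0).env
  initial : ∀ i, (r 0).loc i ∈ E.I i
  step : ∀ k i, (r (k + 1)).loc i =
    E.δ i ((r k).loc i) (r k).env (P i ((r k).loc i))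
      (fun j => if (r k).env k j i = true
        then E.μ j ((r k).loc j) (P j ((r k).loc j)) i else none)

/-- The system generated by `P` and `E`. -/
def system (E : InfoExchange n) (t : ℕ) (P : DecisionProtocol E) : Set (Run E) :=
  {r | IsRun E t P r}

open Classical in
/-- The indexical set of nonfailed agents at the point `(r, m)`. -/
noncomputable def nonfailed (E : InfoExchange n) (r : Run E) (m : ℕ) : Finset (Fin n) :=
  Finset.univ.filter (fun i => (r m).loc i ≠ E.crashed)

/-- Propositions, as predicates of points. -/
abbrev PointProp (E : InfoExchange n) : Type := Run E → ℕ → Prop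

/-- `∃ v`: some agent has initial value `v`. -/
def existsInit (E : InfoExchange n) (v : Value) : PointProp E :=
  fun r _ => ∃ i, E.init i ((r 0).loc i) = v

/-- `K_i φ` in the system `R`. -/
def Knows {E : InfoExchange n} (R : Set (Run E)) (i : Fin n) (φ : PointProp E) : PointProp E :=
  fun r m => ∀ r' ∈ R, ∀ m', (r m).loc i = (r' m').loc i → φ r' m'

/-- `E_N φ` in the system `R`: every nonfailed agent knows `φ`. -/
def EveryoneKnows {E : InfoExchange n} (R : Set (Run E)) (φ : PointProp E) : PointProp E :=
  fun r m => ∀ i ∈ nonfailed E r m, Knows R i φ r m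

/-- `C_N φ` in the system `R`: common knowledge among the nonfailed agents. -/
def CommonKnowledge {E : InfoExchange n} (R : Set (Run E)) (φ : PointProp E) : PointProp E :=
  fun r m => ∀ k : ℕ, 1 ≤ k → ((EveryoneKnows R)^[k] φ) r m

/-- Corresponding runs: same failure pattern and same initial values. -/
def Corresponding {E : InfoExchange n} (r r' : Run E) : Prop :=
  (r 0).env = (r' 0).env ∧ ∀ i, E.init i ((r 0).loc i) = E.init i ((r' 0).loc i)

/-- The specification of simultaneous agreement: Agreement, Validity and Simultaneity. -/
structure IsSBA (E : InfoExchange n) (t : ℕ) (P : DecisionProtocol E) : Prop where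
  agreement : ∀ r ∈ system E t P, ∀ m m', ∀ i ∈ nonfailed E r m, ∀ j ∈ nonfailed E r m',
    ∀ v v', P i ((r m).loc i) = Action.decide v → P j ((r m').loc j) = Action.decide v' → v = v'
  validity : ∀ r ∈ system E t P, ∀ m, ∀ i ∈ nonfailed E r m,
    ∀ v, P i ((r m).loc i) = Action.decide v → existsInit E v r m
  simultaneity : ∀ r ∈ system E t P, ∀ m, ∀ i ∈ nonfailed E r m, ∀ j ∈ nonfailed E r m,
    (∃ v, P i ((r m).loc i) = Action.decide v) → ∃ w, P j ((r m).loc j) = Action.decide w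

/-- Termination: in every run every agent eventually decides or fails. -/
def Terminates (E : InfoExchange n) (t : ℕ) (P : DecisionProtocol E) : Prop :=
  ∀ r ∈ system E t P, ∀ i, ∃ m, i ∉ nonfailed E r m ∨ ∃ v, P i ((r m).loc i) = Action.decide v

/-- `P ≤ P'`: in corresponding runs, whenever a nonfailed agent decides under `P` it also decides
under `P'`. (A crashed agent no longer runs the protocol.) -/
def DecidesOnlyIf (E : InfoExchange n) (t : ℕ) (P P' : DecisionProtocol E) : Prop :=
  ∀ r ∈ system E t P, ∀ r' ∈ system E t P', Corresponding r r' →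
    ∀ m, ∀ i ∈ nonfailed E r m,
      (∃ v, P i ((r m).loc i) = Action.decide v) → ∃ w, P' i ((r' m).loc i) = Action.decide w

/-- `P` is an optimum SBA protocol with respect to `E`: every SBA protocol is below it. -/
def IsOptimumSBA (E : InfoExchange n) (t : ℕ) (P : DecisionProtocol E) : Prop :=
  IsSBA E t P ∧ ∀ P' : DecisionProtocol E, IsSBA E t P' → DecidesOnlyIf E t P' P

/-- Local states of SendWaste: `active W h d m v` has the set `W` of values seen, the number `h`
of messages missing in the last round, the waste estimate `d`, the time `m` and the initial
value `v`. -/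
inductive SendWasteState : Type where
  | crashed : SendWasteState
  | active (W : Finset Value) (h : ℕ) (d : ℤ) (m : ℕ) (v : Value) : SendWasteState

namespace SendWaste

/-- A message carries a set of values and a waste estimate. -/
abbrev Message : Type := Finset Value × ℤ

def initialStates : Set SendWasteState := {s | ∃ v, s = .active {v} 0 0 0 v}

def init : SendWasteState → Value
  | .crashed => 0
  | .active _ _ _ _ v => v

def time : SendWasteState → ℕ
  | .crashed => 0
  | .active _ _ _ m _ => m

/-- An agent sends `(W, d)` to every agent, itself included. -/
def send : SendWasteState → Option Message
  | .crashed => none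
  | .active W _ d _ _ => some (W, d)

/-- The union of the sets of values received. -/
def receivedValues (msgs : Fin n → Option Message) : Finset Value :=
  Finset.univ.biUnion (fun j => (msgs j).elim ∅ Prod.fst)

/-- The number of missing messages. -/
def missing (msgs : Fin n → Option Message) : ℕ :=
  (Finset.univ.filter (fun j => (msgs j).isNone)).card

/-- The maximum of the old estimate `d`, all estimates received, and `h - m`, where `h` is the
number of messages missing in the current round `m`. -/
def newEstimate (d : ℤ) (m : ℕ) (msgs : Fin n → Option Message) : ℤ :=
  Finset.univ.fold max (max d ((missing msgs : ℤ) - (m : ℤ)))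
    (fun j => (msgs j).elim d Prod.snd)

/-- The state update of agent `i`; the round that starts at time `m` is round `m + 1`. -/
def update (i : Fin n) (s : SendWasteState) (F : FailurePattern n)
    (msgs : Fin n → Option Message) : SendWasteState :=
  match s with
  | .crashed => .crashed
  | .active _ _ d m v =>
      if F m i i = false then .crashed
      else .active (receivedValues msgs) (missing msgs) (newEstimate d (m + 1) msgs) (m + 1) v

theorem init_bijOn : Set.BijOn init initialStates Set.univ := by
  refine ⟨fun _ _ => Set.mem_univ _, ?_, ?_⟩
  · rintro _ ⟨v, rfl⟩ _ ⟨w, rfl⟩ h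
    have h' : v = w := h
    rw [h']
  · intro v _
    exact ⟨.active {v} 0 0 0 v, ⟨v, rfl⟩, rfl⟩

theorem update_crash (i : Fin n) (s : SendWasteState) (F : FailurePattern n)
    (msgs : Fin n → Option Message) (h : F (time s) i i = false) :
    update i s F msgs = .crashed := by
  cases s with
  | crashed => rfl
  | active W k d m v => exact if_pos h

end SendWaste

/-- The SendWaste information exchange for `n` agents. -/
def sendWaste (n : ℕ) : InfoExchange n where
  L := SendWasteState
  M := SendWaste.Message
  I := fun _ => SendWaste.initialStates
  init := fun _ => SendWaste.init
  time := fun _ => SendWaste.time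
  crashed := .crashed
  μ := fun _ s _ _ => SendWaste.send s
  δ := fun i s F _ msgs => SendWaste.update i s F msgs
  init_bijOn := fun _ => SendWaste.init_bijOn
  δ_crash := fun i s F _ msgs h => SendWaste.update_crash i s F msgs h
  δ_crashed := fun _ _ _ _ => rfl

/-- The decision protocol `P^send`: decide `min W` as soon as `m ≥ min {t + 1, n - 1} - d`. -/
def pSend (n t : ℕ) : DecisionProtocol (sendWaste n) := fun _ s =>
  match (show SendWasteState from s) with
  | .crashed => Action.noop
  | .active W _ d m _ =>
      if (m : ℤ) ≥ min ((t : ℤ) + 1) ((n : ℤ) - 1) - d then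
        (if hW : W.Nonempty then Action.decide (W.min' hW) else Action.noop)
      else Action.noop

/-- The waste estimate in a local state (with default `0` in the crashed state). -/
def wasteEstimate : SendWasteState → ℤ
  | .crashed => 0
  | .active _ _ d _ _ => d

/-- `d_N (r, m)`: the maximal waste estimate of the nonfailed agents. -/
noncomputable def maxWaste (r : Run (sendWaste n)) (m : ℕ)
    (h : (nonfailed (sendWaste n) r m).Nonempty) : ℤ :=
  (nonfailed (sendWaste n) r m).sup' h (fun i => wasteEstimate ((r m).loc i))

end SBA

namespace SBA

/-! Local states depend only on failure pattern and initial values, never on the protocol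
(`loc_eq_state`), so all protocols can be compared on the same scenarios.

Sufficiency (`exists_origin`, `agreement_of_waste`): an estimate `d` held by a survivor at time `m`
goes back to a time `k` at which at least `d + k` agents had crashed, and since then some survivor
has always held an estimate of at least `d`. If a later round has no new crash, it gives all
survivors the same set of values and an estimate of at least `d`. Otherwise every round since `k`
has a new crash, so at least `d + m ≥ min {t + 1, n - 1}` agents have crashed by time `m`; as at
most `t` crash, only one survivor is left. Either way the survivors share the condition and the
decision, which is therefore common knowledge.

Necessity (`reach_of_waste_lt`): if `d + m ≤ min {t, n - 2}`, a chain of scenarios, neighbours being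
indistinguishable to some survivor at time `m`, leads to arbitrary initial values, so neither `∃ 0`
nor `∃ 1` is common knowledge. Crashes are removed round by round, backwards. Undoing one takes room
for one extra crash in each later round (`reach_uncrash`): silence a receiver, change what it
received, and bring it back. Low waste leaves this room up to a deficit of one, in which case one
crash is first postponed by a round (`reach_postpone_of_max_lost`, `reach_level`).

Optimality follows since a decision in any SBA protocol makes the decided value common knowledge
(`IsSBA.commonKnowledge`). -/

theorem mem_nonfailed {n : ℕ} {E : InfoExchange n} {r : Run E} {m : ℕ} {i : Fin n} :
    i ∈ nonfailed E r m ↔ (r m).loc i ≠ E.crashed := by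
  simp [nonfailed]

namespace SendWaste

/-! ### Local states as functions of failure pattern and initial values. -/

variable {n t : ℕ}

/-- Agent `i` has not crashed at time `m`. -/
def Alive (F : FailurePattern n) (m : ℕ) (i : Fin n) : Prop := ∀ k < m, F k i i = true

/-- The set of values seen by agent `i` at time `m`, as long as `i` is alive. -/
def vals (F : FailurePattern n) (v : Fin n → Value) : ℕ → Fin n → Finset Value
  | 0, i => {v i}
  | m + 1, i => (Finset.univ.filter (fun j => F m j i = true)).biUnion (vals F v m)

/-- The number of messages that agent `i` misses in round `m`. -/
def lost (F : FailurePattern n) : ℕ → Fin n → ℕ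
  | 0, _ => 0
  | m + 1, i => (Finset.univ.filter (fun j => F m j i = false)).card

/-- The waste estimate of agent `i` at time `m`, as long as `i` is alive. -/
def est (F : FailurePattern n) : ℕ → Fin n → ℤ
  | 0, _ => 0
  | m + 1, i => (Finset.univ.filter (fun j => F m j i = true)).fold max
      (max (est F m i) ((lost F (m + 1) i : ℤ) - ((m + 1 : ℕ) : ℤ))) (est F m)

open Classical in
/-- The local state of agent `i` at time `m` as a function of failure pattern and initial
values. -/
noncomputable def state (F : FailurePattern n) (v : Fin n → Value) (m : ℕ) (i : Fin n) :
    SendWasteState :=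
  if Alive F m i then .active (vals F v m i) (lost F m i) (est F m i) m (v i) else .crashed

theorem state_of_alive {F : FailurePattern n} {v : Fin n → Value} {m : ℕ} {i : Fin n}
    (h : Alive F m i) :
    state F v m i = .active (vals F v m i) (lost F m i) (est F m i) m (v i) := if_pos h

theorem state_of_not_alive {F : FailurePattern n} {v : Fin n → Value} {m : ℕ} {i : Fin n}
    (h : ¬ Alive F m i) : state F v m i = .crashed := if_neg h

theorem state_ne_crashed_iff {F : FailurePattern n} {v : Fin n → Value} {m : ℕ} {i : Fin n} :
    state F v m i ≠ .crashed ↔ Alive F m i := by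
  by_cases h : Alive F m i
  · simp [state_of_alive h, h]
  · simp [state_of_not_alive h, h]

theorem Alive.mono {F : FailurePattern n} {m m' : ℕ} {i : Fin n} (h : Alive F m i)
    (hm : m' ≤ m) : Alive F m' i := fun k hk => h k (hk.trans_le hm)

theorem alive_succ {F : FailurePattern n} {m : ℕ} {i : Fin n} :
    Alive F (m + 1) i ↔ Alive F m i ∧ F m i i = true := by
  constructor
  · exact fun h => ⟨h.mono m.le_succ, h m m.lt_succ_self⟩
  · rintro ⟨h, h'⟩ k hk
    rcases Nat.lt_succ_iff_lt_or_eq.mp hk with hk | rfl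
    exacts [h k hk, h']

theorem alive_of_delivered {F : FailurePattern n} (hF : F ∈ Crash n t) {m : ℕ} {i j : Fin n}
    (h : F m i j = true) : Alive F m i := by
  intro k hk
  by_contra hc
  have := hF.2.1 k i (by simpa using hc) m hk j
  simp [this] at h

theorem delivered_of_self {F : FailurePattern n} (hF : F ∈ Crash n t) {m : ℕ} {i j : Fin n}
    (h : F m i i = true) : F m i j = true := by
  by_contra hc
  have := hF.1 m i j (by simpa using hc)
  simp [this] at h

theorem Alive.delivered {F : FailurePattern n} (hF : F ∈ Crash n t) {k m : ℕ} {i j : Fin n}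
    (h : Alive F m i) (hk : k < m) : F k i j = true :=
  delivered_of_self hF (h k hk)

theorem mem_vals_succ {F : FailurePattern n} {v : Fin n → Value} {m : ℕ} {i : Fin n}
    {x : Value} : x ∈ vals F v (m + 1) i ↔ ∃ j, F m j i = true ∧ x ∈ vals F v m j := by
  simp [vals]

/-- Maxima are handled through their upper bounds throughout; two estimates are equal once they have
the same upper bounds. -/
theorem est_succ_le_iff {F : FailurePattern n} {m : ℕ} {i : Fin n} {x : ℤ} :
    est F (m + 1) i ≤ x ↔ est F m i ≤ x ∧ (lost F (m + 1) i : ℤ) - ((m + 1 : ℕ) : ℤ) ≤ x ∧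
      ∀ j, F m j i = true → est F m j ≤ x := by
  rw [est, Finset.fold_max_le]
  simp [and_assoc]

theorem newEstimate_le_iff {d x : ℤ} {m : ℕ} {msgs : Fin n → Option Message} :
    newEstimate d m msgs ≤ x ↔ d ≤ x ∧ (missing msgs : ℤ) - (m : ℤ) ≤ x ∧
      ∀ j, (msgs j).elim d Prod.snd ≤ x := by
  rw [newEstimate, Finset.fold_max_le]
  simp [and_assoc]

theorem update_state {F : FailurePattern n} (hF : F ∈ Crash n t) (v : Fin n → Value) (m : ℕ)
    (i : Fin n) :
    update i (state F v m i) F (fun j => if F m j i = true then send (state F v m j) else none) =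
      state F v (m + 1) i := by
  by_cases hi : Alive F m i
  swap
  · rw [state_of_not_alive hi, state_of_not_alive (fun h => hi (alive_succ.mp h).1)]
    rfl
  rw [state_of_alive hi]
  by_cases hc : F m i i = true
  swap
  · rw [state_of_not_alive (fun h => hc (alive_succ.mp h).2)]
    simp [update, hc]
  rw [state_of_alive (alive_succ.mpr ⟨hi, hc⟩)]
  have hmsg : (fun j => if F m j i = true then send (state F v m j) else none) =
      fun j => if F m j i = true then some (vals F v m j, est F m j) else none := by
    funext j
    split_ifs with h
    · rw [state_of_alive (alive_of_delivered hF h)]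
      rfl
    · rfl
  have hmiss : missing (fun j => if F m j i = true then some (vals F v m j, est F m j) else none)
      = lost F (m + 1) i := by
    rw [missing, lost]
    congr 1
    ext j
    by_cases h : F m j i = true <;> simp [h]
  rw [hmsg]
  simp only [update, hc, Bool.true_eq_false, if_false, hmiss]
  congr 1
  · ext x
    rw [mem_vals_succ, receivedValues, Finset.mem_biUnion]
    refine exists_congr fun j => ?_
    by_cases h : F m j i = true <;> simp [h]
  · refine eq_of_forall_ge_iff fun x => ?_
    rw [newEstimate_le_iff, est_succ_le_iff, hmiss]
    -- An absent message contributes the default `d`, whose bound is already `h1`.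
    refine and_congr_right fun h1 => and_congr_right fun _ => forall_congr' fun j => ?_
    by_cases h : F m j i = true <;> simp [h, h1]

/-- The initial values of a run. -/
def inits (r : Run (sendWaste n)) : Fin n → Value := fun i => init ((r 0).loc i)

/-- Actions enter neither messages nor updates, so `P` does not occur on the right. This is what
carries facts over from one protocol to another. -/
theorem loc_eq_state {P : DecisionProtocol (sendWaste n)} {r : Run (sendWaste n)}
    (hr : r ∈ system (sendWaste n) t P) (m : ℕ) (i : Fin n) :
    (r m).loc i = state (r 0).env (inits r) m i := by
  have hr' : IsRun (sendWaste n) t P r := hr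
  induction m generalizing i with
  | zero =>
    have ha : Alive (r 0).env 0 i := fun k hk => absurd hk (Nat.not_lt_zero k)
    obtain ⟨v, hv⟩ := hr'.initial i
    rw [state_of_alive ha]
    have hv' : inits r i = v := congrArg init hv
    simp only [vals, lost, est, hv']
    exact hv
  | succ m ih =>
    rw [hr'.step m i, hr'.env_const m, ← update_state hr'.env_mem (inits r) m i, ih i]
    simp only [ih]
    rfl

theorem mem_nonfailed_iff {P : DecisionProtocol (sendWaste n)} {r : Run (sendWaste n)}
    (hr : r ∈ system (sendWaste n) t P) {m : ℕ} {i : Fin n} :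
    i ∈ nonfailed (sendWaste n) r m ↔ Alive (r 0).env m i := by
  rw [← state_ne_crashed_iff (v := inits r), ← loc_eq_state hr m i]
  exact mem_nonfailed

/-- The run with a given failure pattern and given initial values. -/
noncomputable def runOf (F : FailurePattern n) (v : Fin n → Value) : Run (sendWaste n) :=
  fun m => ⟨F, state F v m⟩

theorem runOf_mem {F : FailurePattern n} (hF : F ∈ Crash n t) (v : Fin n → Value)
    (P : DecisionProtocol (sendWaste n)) : runOf F v ∈ system (sendWaste n) t P where
  env_mem := hF
  env_const _ := rfl
  initial i := ⟨v i, by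
    have ha : Alive F 0 i := fun k hk => absurd hk (Nat.not_lt_zero k)
    exact state_of_alive ha⟩
  step k i := (update_state hF v k i).symm

theorem inits_runOf (F : FailurePattern n) (v : Fin n → Value) : inits (runOf F v) = v := by
  funext i
  have ha : Alive F 0 i := fun k hk => absurd hk (Nat.not_lt_zero k)
  have : (runOf F v 0).loc i = _ := state_of_alive ha
  rw [inits, this]
  rfl

/-! ### Monotonicity of estimates and values -/

theorem est_le_succ (F : FailurePattern n) (m : ℕ) (i : Fin n) : est F m i ≤ est F (m + 1) i :=
  (est_succ_le_iff.mp le_rfl).1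

theorem est_mono (F : FailurePattern n) (i : Fin n) : Monotone fun m => est F m i :=
  monotone_nat_of_le_succ fun m => est_le_succ F m i

theorem est_nonneg (F : FailurePattern n) (m : ℕ) (i : Fin n) : 0 ≤ est F m i :=
  est_mono F i (Nat.zero_le m)

theorem est_le_of_delivered {F : FailurePattern n} {m : ℕ} {i j : Fin n} (h : F m j i = true) :
    est F m j ≤ est F (m + 1) i :=
  (est_succ_le_iff.mp le_rfl).2.2 j h

theorem lost_sub_le_est (F : FailurePattern n) (m : ℕ) (i : Fin n) :
    (lost F m i : ℤ) - m ≤ est F m i := by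
  cases m with
  | zero => simp [lost, est]
  | succ m => exact (est_succ_le_iff.mp le_rfl).2.1

theorem mem_vals_of_alive {F : FailurePattern n} (v : Fin n → Value) {m : ℕ} {i : Fin n}
    (h : Alive F m i) : v i ∈ vals F v m i := by
  induction m with
  | zero => simp [vals]
  | succ m ih => exact mem_vals_succ.mpr ⟨i, (alive_succ.mp h).2, ih (alive_succ.mp h).1⟩

theorem exists_init_of_mem_vals {F : FailurePattern n} {v : Fin n → Value} {m : ℕ} {i : Fin n}
    {x : Value} (h : x ∈ vals F v m i) : ∃ j, v j = x := by
  induction m generalizing i with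
  | zero => exact ⟨i, by simpa [vals, eq_comm] using h⟩
  | succ m ih =>
    obtain ⟨j, -, hj⟩ := mem_vals_succ.mp h
    exact ih hj

/-- Only agents alive at the start of a round send, and a survivor hears itself, so a set shared by
all survivors is frozen. -/
theorem vals_eq_of_common {F : FailurePattern n} (hF : F ∈ Crash n t) {v : Fin n → Value}
    {W : Finset Value} {k m : ℕ} (hkm : k ≤ m) (h : ∀ i, Alive F k i → vals F v k i = W)
    {i : Fin n} (hi : Alive F m i) : vals F v m i = W := by
  induction m, hkm using Nat.le_induction generalizing i with
  | base => exact h i hi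
  | succ m hkm ih =>
    ext x
    rw [mem_vals_succ]
    constructor
    · rintro ⟨j, hj, hx⟩
      rwa [ih (alive_of_delivered hF hj)] at hx
    · intro hx
      exact ⟨i, (alive_succ.mp hi).2, by rwa [ih (alive_succ.mp hi).1]⟩

/-! ### Rounds without crashes -/

open Classical in
/-- The agents that have crashed at time `m`. -/
noncomputable def dead (F : FailurePattern n) (m : ℕ) : Finset (Fin n) :=
  Finset.univ.filter fun i => ¬ Alive F m i

theorem mem_dead {F : FailurePattern n} {m : ℕ} {i : Fin n} : i ∈ dead F m ↔ ¬ Alive F m i := by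
  simp [dead]

theorem dead_subset_succ (F : FailurePattern n) (m : ℕ) : dead F m ⊆ dead F (m + 1) := by
  intro i hi
  rw [mem_dead] at hi ⊢
  exact fun h => hi (h.mono m.le_succ)

theorem card_dead_le {F : FailurePattern n} (hF : F ∈ Crash n t) (m : ℕ) :
    (dead F m).card ≤ t := by
  refine le_trans ?_ hF.2.2
  rw [← Set.ncard_coe_finset]
  refine Set.ncard_le_ncard (fun i hi => ?_) (Set.toFinite _)
  have hi' := mem_dead.mp hi
  simp only [Alive, not_forall, Bool.not_eq_true] at hi'
  obtain ⟨k, -, hk⟩ := hi'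
  exact ⟨k, i, hk⟩

theorem lost_le_card_dead {F : FailurePattern n} (hF : F ∈ Crash n t) (m : ℕ) (i : Fin n) :
    lost F m i ≤ (dead F m).card := by
  cases m with
  | zero => exact Nat.zero_le _
  | succ m =>
    refine Finset.card_le_card fun j hj => ?_
    rw [mem_dead, alive_succ, not_and]
    intro _
    simpa using hF.1 m j i (Finset.mem_filter.mp hj).2

/-- Traces an estimate back along the messages that carried it to the round whose losses produced
it, or to the initial `0`. The carriers witness that the estimate was never lost in between. -/
theorem exists_origin {F : FailurePattern n} (hF : F ∈ Crash n t) {m : ℕ} {i : Fin n}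
    (hi : Alive F m i) :
    ∃ k ≤ m, est F m i + k ≤ (dead F k).card ∧
      ∀ l, k ≤ l → l ≤ m → ∃ j, Alive F l j ∧ est F m i ≤ est F l j := by
  induction m generalizing i with
  | zero =>
    refine ⟨0, le_rfl, by simp [est], fun l _ hl => ⟨i, ?_, ?_⟩⟩
    · exact hi.mono hl
    · obtain rfl : l = 0 := by omega
      exact le_rfl
  | succ m ih =>
    have key : ∀ j, Alive F m j → est F (m + 1) i ≤ est F m j →
        ∃ k ≤ m + 1, est F (m + 1) i + k ≤ (dead F k).card ∧
          ∀ l, k ≤ l → l ≤ m + 1 → ∃ j, Alive F l j ∧ est F (m + 1) i ≤ est F l j := by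
      intro j hj hle
      obtain ⟨k, hk, hd, hl⟩ := ih hj
      refine ⟨k, by omega, by omega, fun l h1 h2 => ?_⟩
      rcases Nat.le_succ_iff.mp h2 with h2 | rfl
      · obtain ⟨x, hx, hx'⟩ := hl l h1 h2
        exact ⟨x, hx, hle.trans hx'⟩
      · exact ⟨i, hi, le_rfl⟩
    by_contra hcon
    -- Some term of the maximum attains it; without an origin every term would be smaller by at
    -- least one.
    have hlt : est F (m + 1) i ≤ est F (m + 1) i - 1 := by
      refine est_succ_le_iff.mpr ⟨?_, ?_, fun j hj => ?_⟩
      · by_contra h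
        exact hcon (key i (alive_succ.mp hi).1 (by omega))
      · by_contra h
        have h1 := lost_le_card_dead hF (m + 1) i
        refine hcon ⟨m + 1, le_rfl, by omega, fun l h2 h3 => ?_⟩
        obtain rfl : l = m + 1 := by omega
        exact ⟨i, hi, le_rfl⟩
      · by_contra h
        exact hcon (key j (alive_of_delivered hF hj) (by omega))
    omega

/-- In a round without new crashes the set of senders heard does not depend on the receiver. -/
theorem delivered_iff_of_clean {F : FailurePattern n} (hF : F ∈ Crash n t) {k : ℕ}
    (hk : dead F (k + 1) = dead F k) {i j : Fin n} : F k j i = true ↔ Alive F k j := by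
  refine ⟨alive_of_delivered hF, fun h => ?_⟩
  have : Alive F (k + 1) j := by
    rw [← not_not (a := Alive F (k + 1) j), ← mem_dead, hk, mem_dead, not_not]
    exact h
  exact this.delivered hF k.lt_succ_self

theorem vals_eq_of_clean {F : FailurePattern n} (hF : F ∈ Crash n t) (v : Fin n → Value) {k : ℕ}
    (hk : dead F (k + 1) = dead F k) (i j : Fin n) : vals F v (k + 1) i = vals F v (k + 1) j := by
  ext x
  simp only [mem_vals_succ, delivered_iff_of_clean hF hk]

theorem card_dead_of_no_clean {F : FailurePattern n} {k m : ℕ} (hkm : k ≤ m)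
    (h : ∀ l, k ≤ l → l < m → dead F (l + 1) ≠ dead F l) :
    (dead F k).card + (m - k) ≤ (dead F m).card := by
  induction m, hkm using Nat.le_induction with
  | base => simp
  | succ m hkm ih =>
    have h1 := ih fun l h1 h2 => h l h1 (by omega)
    have h2 := Finset.card_lt_card
      ((dead_subset_succ F m).ssubset_of_ne (h m hkm m.lt_succ_self).symm)
    omega

theorem agreement_of_waste {F : FailurePattern n} (hF : F ∈ Crash n t) (v : Fin n → Value)
    {m : ℕ} {i j : Fin n} (hi : Alive F m i) (hj : Alive F m j)
    (hm : (m : ℤ) ≥ min ((t : ℤ) + 1) ((n : ℤ) - 1) - est F m i) :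
    vals F v m i = vals F v m j ∧ (m : ℤ) ≥ min ((t : ℤ) + 1) ((n : ℤ) - 1) - est F m j := by
  obtain ⟨k, hkm, hd, hl⟩ := exists_origin hF hi
  by_cases hc : ∃ l, k ≤ l ∧ l < m ∧ dead F (l + 1) = dead F l
  · obtain ⟨l, hkl, hlm, hclean⟩ := hc
    refine ⟨?_, ?_⟩
    · have h := fun x (_ : Alive F (l + 1) x) => vals_eq_of_clean hF v hclean x i
      rw [vals_eq_of_common hF hlm h hi, vals_eq_of_common hF hlm h hj]
    · obtain ⟨x, hx, hle⟩ := hl l hkl hlm.le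
      have h1 : est F l x ≤ est F (l + 1) j :=
        est_le_of_delivered ((delivered_iff_of_clean hF hclean).mpr hx)
      have h2 : est F (l + 1) j ≤ est F m j := est_mono F j hlm
      omega
  -- One new crash per round gives at least `est F m i + m` crashed agents. With at most `t` crashes
  -- this forces `n - 1` of them, so two distinct survivors are impossible.
  · have h1 := card_dead_of_no_clean hkm fun l h1 h2 h3 => hc ⟨l, h1, h2, h3⟩
    have h2 := card_dead_le hF m
    obtain rfl : i = j := by
      by_contra hne
      have h3 : (dead F m).card + ({i, j} : Finset (Fin n)).card ≤ n := by
        rw [← Finset.card_union_of_disjoint]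
        · exact (Finset.card_le_univ _).trans_eq (Fintype.card_fin n)
        · rw [Finset.disjoint_left]
          intro x hx hx'
          rw [mem_dead] at hx
          rcases Finset.mem_insert.mp hx' with rfl | hx'
          · exact hx hi
          · exact hx (Finset.mem_singleton.mp hx' ▸ hj)
      rw [Finset.card_pair hne] at h3
      omega
    exact ⟨rfl, hm⟩

/-! ### Indistinguishability -/

/-- Agent `i` has the same view in `(F, v)` and `(F', v')` at time `m`. -/
structure SameView (F F' : FailurePattern n) (v v' : Fin n → Value) (m : ℕ) (i : Fin n) :
    Prop where
  vals : vals F v m i = vals F' v' m i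
  lost : lost F m i = lost F' m i
  est : est F m i = est F' m i
  init : v i = v' i

theorem SameView.succ {F F' : FailurePattern n} {v v' : Fin n → Value} {m : ℕ} {i : Fin n}
    (hi : SameView F F' v v' m i) (hF : ∀ j, F m j i = F' m j i)
    (h : ∀ j, F m j i = true → SameView F F' v v' m j) : SameView F F' v v' (m + 1) i := by
  have hl : SendWaste.lost F (m + 1) i = SendWaste.lost F' (m + 1) i := by
    simp only [SendWaste.lost, hF]
  refine ⟨?_, hl, ?_, hi.init⟩
  · ext x
    simp only [mem_vals_succ, ← hF]
    exact exists_congr fun j => and_congr_right fun hj => by rw [(h j hj).vals]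
  · refine eq_of_forall_ge_iff fun x => ?_
    simp only [est_succ_le_iff, ← hF, hl, hi.est]
    refine and_congr_right fun _ => and_congr_right fun _ => forall_congr' fun j => ?_
    exact forall_congr' fun hj => by rw [(h j hj).est]

/-- Views agree outside a set of agents that spreads only by its messages. -/
theorem sameView_of_hidden {F F' : FailurePattern n} {v v' : Fin n → Value} {b m : ℕ}
    (hbm : b ≤ m) (X : ℕ → Set (Fin n)) (h0 : ∀ i ∉ X b, SameView F F' v v' b i)
    (hX : ∀ k, b ≤ k → k < m → ∀ i ∉ X (k + 1), i ∉ X k)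
    (hF : ∀ k, b ≤ k → k < m → ∀ i ∉ X (k + 1), ∀ j, F k j i = F' k j i)
    (hd : ∀ k, b ≤ k → k < m → ∀ i ∉ X (k + 1), ∀ j, F k j i = true → j ∉ X k)
    {i : Fin n} (hi : i ∉ X m) : SameView F F' v v' m i := by
  induction m, hbm using Nat.le_induction generalizing i with
  | base => exact h0 i hi
  | succ m hbm ih =>
    have ih' : ∀ j ∉ X m, SameView F F' v v' m j := fun j hj =>
      ih (fun k h1 h2 => hX k h1 (by omega)) (fun k h1 h2 => hF k h1 (by omega))
        (fun k h1 h2 => hd k h1 (by omega)) hj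
    exact (ih' i (hX m hbm m.lt_succ_self i hi)).succ (hF m hbm m.lt_succ_self i hi)
      fun j hj => ih' j (hd m hbm m.lt_succ_self i hi j hj)

theorem sameView_zero {F F' : FailurePattern n} {v v' : Fin n → Value} {i : Fin n}
    (h : v i = v' i) : SameView F F' v v' 0 i :=
  ⟨by simp [vals, h], rfl, rfl, h⟩

theorem sameView_of_eqOn {F F' : FailurePattern n} (v : Fin n → Value) {m : ℕ}
    (h : ∀ k < m, F k = F' k) (i : Fin n) : SameView F F' v v m i :=
  sameView_of_hidden (Nat.zero_le m) (fun _ => ∅) (fun _ _ => sameView_zero rfl)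
    (fun _ _ _ _ _ => id) (fun k _ hk _ _ _ => by rw [h k hk]) (fun _ _ _ _ _ _ _ => id)
    (Set.notMem_empty i)

/-- If `j` sends nothing from time `b` on, the others notice no change in what `j` receives
before time `b`, or in the state of `j` at time `b`. -/
theorem sameView_of_silent {F F' : FailurePattern n} {v v' : Fin n → Value} {m b : ℕ} {j : Fin n}
    (hv : ∀ i ≠ j, v i = v' i) (hvb : b ≠ 0 → v = v')
    (hs : ∀ k < m, b ≤ k → ∀ i, F k j i = false)
    (hF : ∀ k < m, ∀ i x, (i = j → k + 1 < b) → F k x i = F' k x i)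
    {i : Fin n} (hi : i ≠ j) : SameView F F' v v' m i := by
  refine sameView_of_hidden (Nat.zero_le m) (fun k => {x | x = j ∧ b ≤ k}) ?_ ?_ ?_ ?_
    (fun h => hi h.1)
  · intro x hx
    refine sameView_zero ?_
    by_cases hxj : x = j
    · have : b ≠ 0 := fun hb => hx ⟨hxj, hb.le⟩
      rw [hvb this]
    · exact hv x hxj
  · exact fun k _ _ x hx h => hx ⟨h.1, h.2.trans k.le_succ⟩
  · exact fun k _ hk x hx y => hF k hk x y fun h => not_le.mp fun h' => hx ⟨h, h'⟩
  · rintro k - hk x hx y hy ⟨rfl, h⟩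
    rw [hs k hk h x] at hy
    exact Bool.false_ne_true hy

/-! ### Scenarios and chains of indistinguishability at a fixed time. -/

/-- A failure pattern with initial values. -/
abbrev Scenario (n : ℕ) : Type := FailurePattern n × (Fin n → Value)

/-- Two scenarios with at most `t` crashes that some nonfailed agent cannot distinguish at
time `m`. -/
def Adjacent (t m : ℕ) (a b : Scenario n) : Prop :=
  a.1 ∈ Crash n t ∧ b.1 ∈ Crash n t ∧
    ∃ i, Alive a.1 m i ∧ Alive b.1 m i ∧ state a.1 a.2 m i = state b.1 b.2 m i

/-- The reflexive and transitive closure of indistinguishability. -/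
def Reach (t m : ℕ) : Scenario n → Scenario n → Prop := Relation.ReflTransGen (Adjacent t m)

theorem Adjacent.symm {m : ℕ} {a b : Scenario n} (h : Adjacent t m a b) : Adjacent t m b a := by
  obtain ⟨h1, h2, i, h3, h4, h5⟩ := h
  exact ⟨h2, h1, i, h4, h3, h5.symm⟩

theorem Reach.symm {m : ℕ} {a b : Scenario n} (h : Reach t m a b) : Reach t m b a :=
  have : Std.Symm (Adjacent (n := n) t m) := ⟨fun _ _ => Adjacent.symm⟩
  Relation.ReflTransGen.stdSymm.symm _ _ h

theorem Reach.trans {m : ℕ} {a b c : Scenario n} (h : Reach t m a b) (h' : Reach t m b c) :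
    Reach t m a c := Relation.ReflTransGen.trans h h'

theorem Reach.refl {m : ℕ} (a : Scenario n) : Reach t m a a := Relation.ReflTransGen.refl

theorem reach_of_sameView {F F' : FailurePattern n} {v v' : Fin n → Value} {m : ℕ} {i : Fin n}
    (hF : F ∈ Crash n t) (hF' : F' ∈ Crash n t) (hi : Alive F m i) (hi' : Alive F' m i)
    (h : SameView F F' v v' m i) : Reach t m (F, v) (F', v') := by
  refine Relation.ReflTransGen.single ⟨hF, hF', i, hi, hi', ?_⟩
  simp only [state_of_alive hi, state_of_alive hi', h.vals, h.lost, h.est, h.init]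

/-! ### Failure patterns given by crash times -/

/-- The failure pattern in which agent `i` crashes in the round from `c i` to `c i + 1`, when its
messages still reach the agents in `S i`; agents with `m ≤ c i` do not crash. -/
def pattern (m : ℕ) (c : Fin n → ℕ) (S : Fin n → Finset (Fin n)) : FailurePattern n :=
  -- Excluding `j = i` keeps the crash a crash even if `S i` is everything.
  fun k i j => decide (m ≤ c i ∨ k < c i ∨ (k = c i ∧ j ∈ S i ∧ j ≠ i))

theorem pattern_eq_true {m : ℕ} {c : Fin n → ℕ} {S : Fin n → Finset (Fin n)} {k : ℕ}
    {i j : Fin n} :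
    pattern m c S k i j = true ↔ m ≤ c i ∨ k < c i ∨ (k = c i ∧ j ∈ S i ∧ j ≠ i) := by
  simp [pattern]

theorem pattern_eq_false {m : ℕ} {c : Fin n → ℕ} {S : Fin n → Finset (Fin n)} {k : ℕ}
    {i j : Fin n} :
    pattern m c S k i j = false ↔ ¬ (m ≤ c i ∨ k < c i ∨ (k = c i ∧ j ∈ S i ∧ j ≠ i)) := by
  simp [pattern]

/-- The number of agents that crash before time `m`. -/
def crashes (m : ℕ) (c : Fin n → ℕ) : ℕ := (Finset.univ.filter fun i => c i < m).card

theorem pattern_mem_crash {m : ℕ} {c : Fin n → ℕ} (S : Fin n → Finset (Fin n))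
    (h : crashes m c ≤ t) : pattern m c S ∈ Crash n t := by
  refine ⟨fun k i j hk => ?_, fun k i hk k' hk' j => ?_, ?_⟩
  · rw [pattern_eq_false] at hk ⊢
    simp only [ne_eq, not_true_eq_false, and_false, or_false]
    tauto
  · rw [pattern_eq_false] at hk ⊢
    push Not at hk ⊢
    exact ⟨hk.1, by omega, fun h => by omega⟩
  · refine le_trans ?_ h
    rw [crashes, ← Set.ncard_coe_finset]
    refine Set.ncard_le_ncard ?_ (Set.toFinite _)
    rintro i ⟨k, j, hk⟩
    rw [pattern_eq_false] at hk
    simp only [Finset.coe_filter, Finset.mem_univ, true_and, Set.mem_ofPred_eq]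
    omega

theorem pattern_alive {m : ℕ} {c : Fin n → ℕ} {S : Fin n → Finset (Fin n)} {i : Fin n}
    (h : m ≤ c i) : Alive (pattern m c S) m i := fun _ _ => pattern_eq_true.mpr (Or.inl h)

theorem crashes_update_le (m : ℕ) (c : Fin n → ℕ) (j : Fin n) (a : ℕ) :
    crashes m (Function.update c j a) ≤ crashes m c + 1 := by
  refine (Finset.card_le_card fun i hi => ?_).trans
    (Finset.card_insert_le j (Finset.univ.filter fun i => c i < m))
  by_cases h : i = j
  · simp [h]
  · simpa [h] using hi

theorem crashes_update_le_of_lt {m : ℕ} {c : Fin n → ℕ} {j : Fin n} (hj : c j < m) (a : ℕ) :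
    crashes m (Function.update c j a) ≤ crashes m c := by
  refine Finset.card_le_card fun i hi => ?_
  by_cases h : i = j
  · simpa [h] using hj
  · simpa [h] using hi

theorem crashes_update_self {m : ℕ} {c : Fin n → ℕ} {j : Fin n} (hj : c j < m) :
    crashes m (Function.update c j m) + 1 = crashes m c := by
  have : (Finset.univ.filter fun i => c i < m) =
      insert j (Finset.univ.filter fun i => Function.update c j m i < m) := by
    ext i
    by_cases h : i = j
    · simp [h, hj]
    · simp [h]
  rw [crashes, crashes, this, Finset.card_insert_of_notMem (by simp)]

theorem exists_ne_of_crashes {m : ℕ} {c : Fin n → ℕ} (h : crashes m c + 2 ≤ n) (j : Fin n) :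
    ∃ i ≠ j, m ≤ c i := by
  by_contra hc
  push Not at hc
  have : (Finset.univ : Finset (Fin n)) ⊆ insert j (Finset.univ.filter fun i => c i < m) := by
    intro i _
    by_cases hi : i = j
    · simp [hi]
    · simp [hc i hi]
  have h1 := (Finset.card_le_card this).trans (Finset.card_insert_le _ _)
  rw [Finset.card_univ, Fintype.card_fin] at h1
  unfold crashes at h
  omega

theorem pattern_congr {m : ℕ} {c c' : Fin n → ℕ} {S S' : Fin n → Finset (Fin n)}
    (h : ∀ i, (m ≤ c i ∧ m ≤ c' i) ∨ (c i = c' i ∧ S i = S' i)) :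
    pattern m c S = pattern m c' S' := by
  funext k i j
  rw [Bool.eq_iff_iff, pattern_eq_true, pattern_eq_true]
  rcases h i with h | h
  · simp [h.1, h.2]
  · rw [h.1, h.2]

theorem crashes_update_le_of_ge {m : ℕ} (c : Fin n → ℕ) (j : Fin n) {a : ℕ} (ha : m ≤ a) :
    crashes m (Function.update c j a) ≤ crashes m c := by
  refine Finset.card_le_card fun i hi => ?_
  by_cases h : i = j
  · rw [Finset.mem_filter, h, Function.update_self] at hi
    omega
  · simpa [h] using hi

/-- Only `j` can notice whether it got the last message of `i`, and `j` is silent afterwards. The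
bound by `n` provides a survivor other than `j` as the witness. -/
theorem reach_insert {m : ℕ} {c : Fin n → ℕ} {S S' : Fin n → Finset (Fin n)} {i j : Fin n}
    (v : Fin n → Value) (ht : crashes m c ≤ t) (hn : crashes m c + 2 ≤ n)
    (hs : ∀ k < m, c i + 1 ≤ k → ∀ x, pattern m c S k j x = false)
    (hi : S' i = insert j (S i)) (hS : ∀ x ≠ i, S' x = S x) :
    Reach t m (pattern m c S, v) (pattern m c S', v) := by
  obtain ⟨l, hlj, hl⟩ := exists_ne_of_crashes hn j
  refine reach_of_sameView (pattern_mem_crash S ht) (pattern_mem_crash S' ht) (pattern_alive hl)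
    (pattern_alive hl) (sameView_of_silent (fun _ _ => rfl) (fun _ => rfl) hs ?_ hlj)
  intro k _ y x hy
  rw [Bool.eq_iff_iff, pattern_eq_true, pattern_eq_true]
  by_cases hx : x = i
  · subst hx
    rw [hi, Finset.mem_insert]
    by_cases hyj : y = j
    · have := hy hyj
      simp only [show k < c x by omega, true_or, or_true]
    · simp [hyj]
  · rw [hS x hx]

/-- A crash after reaching everybody else differs from a crash one round later that reaches nobody
only in the state of the crashing agent. -/
theorem reach_postpone {m : ℕ} {c : Fin n → ℕ} {S : Fin n → Finset (Fin n)} {i : Fin n}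
    (v : Fin n → Value) (ht : crashes m c ≤ t) (hn : crashes m c + 2 ≤ n) (hi : c i < m)
    (hS : S i = Finset.univ) :
    Reach t m (pattern m c S, v)
      (pattern m (Function.update c i (c i + 1)) (Function.update S i ∅), v) := by
  obtain ⟨l, hli, hl⟩ := exists_ne_of_crashes hn i
  refine reach_of_sameView (pattern_mem_crash S ht)
    (pattern_mem_crash _ ((crashes_update_le_of_lt hi _).trans ht)) (pattern_alive hl)
    (pattern_alive (by rwa [Function.update_of_ne hli]))
    (sameView_of_silent (b := c i + 1) (fun _ _ => rfl) (fun _ => rfl) ?_ ?_ hli)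
  · intro k hk hki x
    rw [pattern_eq_false]
    omega
  · intro k hk y x hy
    rw [Bool.eq_iff_iff, pattern_eq_true, pattern_eq_true]
    by_cases hx : x = i
    · subst hx
      simp only [hS, Finset.mem_univ, true_and, Function.update_self, Finset.notMem_empty,
        false_and, and_false, or_false]
      by_cases hyx : y = x
      · have := hy hyx
        omega
      · simp only [ne_eq, hyx, not_false_eq_true, and_true]
        omega
    · rw [Function.update_of_ne hx, Function.update_of_ne hx]

/-! ### Removing crashes, from the last round back to the first. -/

/-- Any crash in the last round with crashes can be undone, if there is room for one more crash
in each later round. -/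
theorem reach_uncrash {m C : ℕ} (hCt : C ≤ t) (hCn : C + 2 ≤ n) (v : Fin n → Value) (e : ℕ) :
    ∀ (a : ℕ) (c : Fin n → ℕ) (S : Fin n → Finset (Fin n)) (i : Fin n), a + e + 1 = m →
      (∀ x, c x ≤ a ∨ m ≤ c x) → c i = a → crashes m c + e ≤ C →
      Reach t m (pattern m c S, v) (pattern m (Function.update c i m) S, v) := by
  induction e using Nat.strong_induction_on with
  | _ e ih =>
  intro a c S i ha hc hi hC
  -- A survivor may be silenced from time `a + 1` on: for `e = 0` this is no crash before time `m`
  -- at all, otherwise the induction hypothesis undoes it.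
  have hsil : ∀ (c : Fin n → ℕ) (S : Fin n → Finset (Fin n)) (j : Fin n),
      (∀ x, c x ≤ a ∨ m ≤ c x) → m ≤ c j → crashes m c + e ≤ C →
      Reach t m (pattern m c S, v)
        (pattern m (Function.update c j (a + 1)) (Function.update S j ∅), v) := by
    intro c S j hc hj hC
    rcases Nat.eq_zero_or_pos e with he | he
    · rw [pattern_congr (c' := Function.update c j (a + 1)) (S' := Function.update S j ∅)]
      · exact Reach.refl _
      · intro x
        by_cases hx : x = j
        · subst hx
          exact Or.inl ⟨hj, by rw [Function.update_self]; omega⟩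
        · simp [hx]
    · have h1 := crashes_update_le m c j (a + 1)
      have h2 := ih (e - 1) (by omega) (a + 1) (Function.update c j (a + 1))
        (Function.update S j ∅) j (by omega) (fun x => by
          by_cases hx : x = j
          · subst hx
            exact Or.inl (by rw [Function.update_self])
          · rw [Function.update_of_ne hx]
            have := hc x
            omega) (Function.update_self ..) (by omega)
      have h3 : pattern m (Function.update (Function.update c j (a + 1)) j m)
          (Function.update S j ∅) = pattern m c S := by
        refine pattern_congr fun x => ?_
        by_cases hx : x = j
        · subst hx
          simp [hj]
        · simp [hx]
      rw [h3] at h2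
      exact h2.symm
  -- A receiver that has crashed is silent already; a survivor is silenced, given the message, and
  -- restored.
  have htog : ∀ (S : Fin n → Finset (Fin n)) (j : Fin n), Reach t m (pattern m c S, v)
      (pattern m c (Function.update S i (insert j (S i))), v) := by
    intro S j
    rcases hc j with hj | hj
    · refine reach_insert v (i := i) (j := j) (by omega) (by omega) (fun k hk hki x => ?_)
        (Function.update_self ..) (fun x hx => Function.update_of_ne hx ..)
      rw [pattern_eq_false]
      omega
    · have hji : j ≠ i := by
        rintro rfl
        omega
      have h1 : crashes m (Function.update c j (a + 1)) ≤ C := by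
        rcases Nat.eq_zero_or_pos e with he | he
        · have := crashes_update_le_of_ge c j (m := m) (a := a + 1) (by omega)
          omega
        · have := crashes_update_le m c j (a + 1)
          omega
      refine ((hsil c S j hc hj hC).trans ?_).trans (hsil c _ j hc hj hC).symm
      refine reach_insert v (i := i) (j := j) (by omega) (by omega) (fun k hk hki x => ?_) ?_
        (fun x hx => ?_)
      · rw [pattern_eq_false]
        simp only [Function.update_self, Function.update_of_ne hji.symm] at hki ⊢
        simp only [Finset.notMem_empty, false_and, and_false, or_false]
        omega
      · simp [hji.symm]
      · by_cases hxj : x = j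
        · simp [hxj]
        · simp [hxj, hx]
  have hall : ∀ s : Finset (Fin n), Reach t m (pattern m c S, v)
      (pattern m c (Function.update S i (s ∪ S i)), v) := by
    intro s
    induction s using Finset.induction_on with
    | empty => simpa using Reach.refl _
    | insert j s _ ih' =>
      refine ih'.trans ?_
      simpa [Finset.insert_union] using htog (Function.update S i (s ∪ S i)) j
  -- With all its messages delivered, the crash moves to the next round, where it is a silencing
  -- that `hsil` undoes.
  refine (hall Finset.univ).trans ?_
  have hlt : c i < m := by omega
  have h1 := crashes_update_self hlt
  refine (reach_postpone v (i := i) (by omega) (by omega) hlt (by simp)).trans ?_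
  have h2 := hsil (Function.update c i m) S i (fun x => by
    by_cases hx : x = i
    · simp [hx]
    · simpa [hx] using hc x) (by simp) (by omega)
  simpa [hi] using h2.symm

/-- If a message of a crash has reached the nonfailed agent that misses the most, then nobody who
survives notices a postponement of this crash by one round. -/
theorem reach_postpone_of_max_lost {m a : ℕ} {c : Fin n → ℕ} {S : Fin n → Finset (Fin n)}
    {i p : Fin n} (v : Fin n → Value) (hc : ∀ x, c x ≤ a ∨ m ≤ c x) (ha : a + 1 < m)
    (hi : c i = a) (hp : m ≤ c p) (hip : p ∈ S i) (ht : crashes m c ≤ t)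
    (hmax : ∀ l, m ≤ c l → lost (pattern m c S) (a + 1) l ≤ lost (pattern m c S) (a + 1) p) :
    Reach t m (pattern m c S, v)
      (pattern m (Function.update c i (a + 1)) (Function.update S i ∅), v) := by
  have hlt : c i < m := by omega
  have hpi : p ≠ i := by
    rintro rfl
    omega
  have hp' : m ≤ Function.update c i (a + 1) p := by rwa [Function.update_of_ne hpi]
  have hFC := pattern_mem_crash S ht
  have hFC' := pattern_mem_crash (Function.update S i ∅)
    ((crashes_update_le_of_lt hlt (a + 1)).trans ht)
  have hFp := pattern_alive (S := S) hp
  have hFp' := pattern_alive (S := Function.update S i ∅) hp'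
  have hne : ∀ k x l, x ≠ i → pattern m c S k x l =
      pattern m (Function.update c i (a + 1)) (Function.update S i ∅) k x l := by
    intro k x l hx
    simp only [pattern, Function.update_of_ne hx]
  have hi1 : ∀ l, pattern m (Function.update c i (a + 1)) (Function.update S i ∅) a i l = true :=
    fun l => pattern_eq_true.mpr (Or.inr (Or.inl (by rw [Function.update_self]; omega)))
  have heq : ∀ k, k ≠ a → pattern m c S k =
      pattern m (Function.update c i (a + 1)) (Function.update S i ∅) k := by
    intro k hk
    funext x l
    by_cases hx : x = i
    · subst hx
      rw [Bool.eq_iff_iff, pattern_eq_true, pattern_eq_true]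
      simp only [Function.update_self, Finset.notMem_empty, false_and, and_false, or_false]
      omega
    · exact hne k x l hx
  have hFa : pattern m c S a i p = true := pattern_eq_true.mpr (Or.inr (Or.inr ⟨hi.symm, hip, hpi⟩))
  have hal : ∀ k x l, a < k → pattern m c S k x l = true → m ≤ c x := by
    intro k x l hk h
    rw [pattern_eq_true] at h
    have := hc x
    omega
  have hfull : ∀ k x l, m ≤ c x → pattern m c S k x l = true := fun k x l hx =>
    pattern_eq_true.mpr (Or.inl hx)
  generalize pattern m c S = F at *
  generalize pattern m (Function.update c i (a + 1)) (Function.update S i ∅) = F' at *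
  have hmono : ∀ x l, F a x l = true → F' a x l = true := by
    intro x l h
    by_cases hx : x = i
    · rw [hx]
      exact hi1 l
    · rwa [← hne a x l hx]
  have hconv : ∀ x l, F' a x l = true → x = i ∨ F a x l = true := by
    intro x l h
    by_cases hx : x = i
    · exact Or.inl hx
    · exact Or.inr (by rwa [hne a x l hx])
  have hva : ∀ l, SameView F F' v v a l := sameView_of_eqOn v fun k hk => heq k hk.ne
  have hvp : SameView F F' v v (a + 1) p := by
    refine (hva p).succ (fun j => ?_) fun j _ => hva j
    by_cases hj : j = i
    · rw [hj, hFa, hi1]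
    · exact hne a j p hj
  have hlost : ∀ l, lost F' (a + 1) l ≤ lost F (a + 1) l := by
    refine fun l => Finset.card_le_card fun x hx => ?_
    simp only [Finset.mem_filter, Finset.mem_univ, true_and] at hx ⊢
    by_contra h
    have := hmono x l (by simpa using h)
    simp [this] at hx
  -- Single estimates may drop, but not their maximum over the survivors: `p` has the same view in
  -- both patterns, has the largest loss, and already holds what `i` sends.
  have hest : ∀ z, (∀ x, m ≤ c x → est F (a + 1) x ≤ z) ↔
      ∀ x, m ≤ c x → est F' (a + 1) x ≤ z := by
    refine fun z => ⟨fun h x hx => ?_, fun h x hx => ?_⟩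
    · have hx' := est_succ_le_iff.mp (h x hx)
      refine est_succ_le_iff.mpr ⟨(hva x).est ▸ hx'.1, ?_, fun y hy => ?_⟩
      · have := hlost x
        omega
      · rw [← (hva y).est]
        rcases hconv y x hy with rfl | hy
        · exact (est_le_of_delivered hFa).trans (h p hp)
        · exact hx'.2.2 y hy
    · have hx' := est_succ_le_iff.mp (h x hx)
      have hp'' := est_succ_le_iff.mp (h p hp)
      refine est_succ_le_iff.mpr ⟨(hva x).est ▸ hx'.1, ?_, fun y hy => ?_⟩
      · have h1 := hmax x hx
        rw [hvp.lost] at h1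
        omega
      · rw [(hva y).est]
        exact hx'.2.2 y (hmono y x hy)
  have hvals : ∀ y, (∃ x, m ≤ c x ∧ y ∈ vals F v (a + 1) x) ↔
      ∃ x, m ≤ c x ∧ y ∈ vals F' v (a + 1) x := by
    refine fun y => ⟨?_, ?_⟩
    · rintro ⟨x, hx, hy⟩
      obtain ⟨z, hz, hy⟩ := mem_vals_succ.mp hy
      exact ⟨x, hx, mem_vals_succ.mpr ⟨z, hmono z x hz, (hva z).vals ▸ hy⟩⟩
    · rintro ⟨x, hx, hy⟩
      obtain ⟨z, hz, hy⟩ := mem_vals_succ.mp hy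
      rw [← (hva z).vals] at hy
      rcases hconv z x hz with rfl | hz
      · exact ⟨p, hp, mem_vals_succ.mpr ⟨z, hFa, hy⟩⟩
      · exact ⟨x, hx, mem_vals_succ.mpr ⟨z, hz, hy⟩⟩
  have hdel : ∀ x l, F (a + 1) x l = true ↔ m ≤ c x := fun x l =>
    ⟨hal (a + 1) x l a.lt_succ_self, fun hx => hfull (a + 1) x l hx⟩
  -- In the next round exactly the survivors are heard, so only the maximum of their estimates and
  -- the union of their sets matter.
  have hv2 : ∀ l, m ≤ c l → SameView F F' v v (a + 2) l := by
    intro l hl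
    have h1 : F (a + 1) = F' (a + 1) := heq _ (by omega)
    have h2 : lost F (a + 2) l = lost F' (a + 2) l := by simp only [lost, h1]
    refine ⟨?_, h2, ?_, rfl⟩
    · ext y
      rw [mem_vals_succ, mem_vals_succ, ← h1]
      simpa only [hdel] using hvals y
    · refine eq_of_forall_ge_iff fun z => ?_
      rw [est_succ_le_iff (m := a + 1), est_succ_le_iff (m := a + 1), ← h1, h2]
      simp only [hdel]
      constructor
      · rintro ⟨-, h3, h4⟩
        exact ⟨(hest z).mp h4 l hl, h3, (hest z).mp h4⟩
      · rintro ⟨-, h3, h4⟩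
        exact ⟨(hest z).mpr h4 l hl, h3, (hest z).mpr h4⟩
  refine reach_of_sameView hFC hFC' hFp hFp' (sameView_of_hidden (b := a + 2) ha
    (fun _ => {l | ¬ m ≤ c l}) (fun l hl => hv2 l (not_not.mp hl)) (fun _ _ _ _ => id)
    (fun k hk _ l _ j => by rw [heq k (by omega)])
    (fun k hk _ l _ j hj h => h (hal k j l (by omega) hj)) (not_not.mpr hp))

/-- All crashes in the last round with crashes can be undone, if there is room for one more crash
in each later round. -/
theorem reach_uncrash_all {m C a e : ℕ} (hCt : C ≤ t) (hCn : C + 2 ≤ n) (v : Fin n → Value)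
    {c : Fin n → ℕ} (S : Fin n → Finset (Fin n)) (ha : a + e + 1 = m)
    (hc : ∀ x, c x ≤ a ∨ m ≤ c x) (hC : crashes m c + e ≤ C) :
    Reach t m (pattern m c S, v) (pattern m (fun x => if c x < a then c x else m) S, v) := by
  have key : ∀ s : Finset (Fin n), (∀ i ∈ s, c i = a) →
      Reach t m (pattern m c S, v) (pattern m (fun x => if x ∈ s then m else c x) S, v) := by
    intro s
    induction s using Finset.induction_on with
    | empty => exact fun _ => by simpa using Reach.refl _
    | insert j s hj ih =>
      intro h
      refine (ih fun i hi => h i (Finset.mem_insert_of_mem hi)).trans ?_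
      have hle : crashes m (fun x => if x ∈ s then m else c x) ≤ crashes m c := by
        refine Finset.card_le_card fun x hx => ?_
        by_cases hxs : x ∈ s
        · simp [hxs] at hx
        · simpa [hxs] using hx
      have h1 := reach_uncrash hCt hCn v e a (fun x => if x ∈ s then m else c x) S j ha
        (fun x => by
          by_cases hxs : x ∈ s
          · simp [hxs]
          · simpa [hxs] using hc x)
        (by simpa [hj] using h j (Finset.mem_insert_self j s)) (by omega)
      convert h1 using 3
      funext x
      by_cases hxj : x = j
      · simp [hxj]
      · simp [hxj]
  refine (key (Finset.univ.filter fun x => c x = a) (by simp)).trans ?_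
  rw [pattern_congr (c' := fun x => if c x < a then c x else m) (S' := S)]
  · exact Reach.refl _
  · intro x
    have := hc x
    simp only [Finset.mem_filter, Finset.mem_univ, true_and, and_true]
    split_ifs <;> omega

/-- With at most `D + a + 1` crashes, one more in each of the `m - a - 1` later rounds keeps within
`D + m ≤ C`. The only other case is `D + a + 2` crashes, one too many; postponing a crash leaves one
round fewer to provide for. -/
theorem reach_level {m C D a : ℕ} (hCt : C ≤ t) (hCn : C + 2 ≤ n) (hD : D + m ≤ C)
    (v : Fin n → Value) {c : Fin n → ℕ} {S : Fin n → Finset (Fin n)} (ha : a < m)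
    (hc : ∀ x, c x ≤ a ∨ m ≤ c x) (hm : a + 1 = m → crashes m c ≤ D + m)
    (h1 : a + 1 < m → crashes m c ≤ D + a + 2)
    (h2 : a + 1 < m → ∀ l, m ≤ c l → lost (pattern m c S) (a + 1) l ≤ D + a + 1) :
    Reach t m (pattern m c S, v) (pattern m (fun x => if c x < a then c x else m) S, v) := by
  by_cases hle : crashes m c ≤ D + a + 1
  · exact reach_uncrash_all (e := m - a - 1) hCt hCn v S (by omega) hc (by omega)
  have ha' : a + 1 < m := by omega
  have h1' := h1 ha'
  obtain ⟨l, -, hl⟩ := exists_ne_of_crashes (m := m) (c := c) (by omega) (⟨0, by omega⟩ : Fin n)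
  obtain ⟨p, hp, hmax⟩ := Finset.exists_max_image (Finset.univ.filter fun x => m ≤ c x)
    (fun x => lost (pattern m c S) (a + 1) x) ⟨l, by simpa using hl⟩
  simp only [Finset.mem_filter, Finset.mem_univ, true_and] at hp hmax
  -- There are more crashes than messages lost by `p`, so some crashing agent still reached `p`.
  obtain ⟨i, him, hi⟩ : ∃ i, c i < m ∧ pattern m c S a i p = true := by
    by_contra hcon
    push Not at hcon
    have : crashes m c ≤ lost (pattern m c S) (a + 1) p := by
      refine Finset.card_le_card fun x hx => ?_
      simpa using hcon x (by simpa using hx)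
    have := h2 ha' p hp
    omega
  obtain ⟨hia, hip⟩ : c i = a ∧ p ∈ S i := by
    have := hc i
    rcases pattern_eq_true.mp hi with h | h | h
    · omega
    · omega
    · exact ⟨h.1.symm, h.2.1⟩
  have hcr := crashes_update_le_of_lt him (a + 1)
  have hcr' := crashes_update_self him
  refine (reach_postpone_of_max_lost v hc ha' hia hp hip (by omega) hmax).trans ?_
  -- The room now suffices exactly: `(D + a + 2) + (m - a - 2) = D + m`.
  refine (reach_uncrash hCt hCn v (m - a - 2) (a + 1) _ _ i (by omega) (fun x => ?_)
    (Function.update_self ..) (by omega)).trans ?_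
  · by_cases hx : x = i
    · simp [hx]
    · rw [Function.update_of_ne hx]
      have := hc x
      omega
  rw [Function.update_idem, pattern_congr (c' := Function.update c i m) (S' := S)]
  · have h3 := reach_uncrash_all (t := t) (e := m - a - 1) (m := m) (a := a) (C := C) hCt hCn v
      (c := Function.update c i m) S (by omega) (fun x => by
        by_cases hx : x = i
        · simp [hx]
        · simpa [hx] using hc x) (by omega)
    convert h3 using 3
    funext x
    by_cases hx : x = i
    · subst hx
      simp only [Function.update_self]
      split_ifs <;> omega
    · rw [Function.update_of_ne hx]
  · intro x
    by_cases hx : x = i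
    · simp [hx]
    · simp [hx]

theorem reach_crash_free {m C D : ℕ} (hCt : C ≤ t) (hCn : C + 2 ≤ n) (hD : D + m ≤ C)
    (v : Fin n → Value) {c : Fin n → ℕ} {S : Fin n → Finset (Fin n)} (hm : crashes m c ≤ D + m)
    (h1 : ∀ a, a + 1 < m → (Finset.univ.filter fun x => c x ≤ a).card ≤ D + a + 2)
    (h2 : ∀ a, a + 1 < m → ∀ l, a < c l →
      (Finset.univ.filter fun x => c x < a ∨ (c x = a ∧ l ∉ S x)).card ≤ D + a + 1) :
    Reach t m (pattern m c S, v) (pattern m (fun _ => m) S, v) := by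
  have key : ∀ e ≤ m, Reach t m (pattern m c S, v)
      (pattern m (fun x => if c x < m - e then c x else m) S, v) := by
    intro e
    induction e with
    | zero =>
      intro _
      rw [pattern_congr (c' := fun x => if c x < m - 0 then c x else m) (S' := S)]
      · exact Reach.refl _
      · intro x
        simp only [and_true]
        split_ifs <;> omega
    | succ e ih =>
      intro he
      refine (ih (by omega)).trans ?_
      have hcr : crashes m (fun x => if c x < m - e then c x else m) ≤ crashes m c := by
        refine Finset.card_le_card fun x hx => ?_
        simp only [Finset.mem_filter, Finset.mem_univ, true_and] at hx ⊢
        split_ifs at hx <;> omega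
      have hcr' : crashes m (fun x => if c x < m - e then c x else m) ≤
          (Finset.univ.filter fun x => c x ≤ m - e - 1).card := by
        refine Finset.card_le_card fun x hx => ?_
        simp only [Finset.mem_filter, Finset.mem_univ, true_and] at hx ⊢
        split_ifs at hx <;> omega
      have h3 := reach_level (a := m - e - 1) hCt hCn hD v (S := S)
        (c := fun x => if c x < m - e then c x else m) (by omega)
        (fun x => by split_ifs <;> omega) (fun _ => by omega)
        (fun h => by
          have := h1 _ h
          omega)
        (fun h l hl => by
          refine le_trans (Finset.card_le_card fun x hx => ?_) (h2 _ h l ?_)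
          · simp only [Finset.mem_filter, Finset.mem_univ, true_and, pattern_eq_false] at hx ⊢
            by_cases hxl : l = x
            · subst hxl
              exact absurd (Or.inl hl) hx
            · simp only [ne_eq, hxl, not_false_eq_true, and_true] at hx
              by_cases hxc : c x < m - e
              · simp only [hxc, if_true] at hx
                by_cases hS : l ∈ S x
                · simp only [hS, and_true, not_true_eq_false, and_false, or_false] at hx ⊢
                  omega
                · simp only [hS, not_false_eq_true, and_true]
                  omega
              · simp [hxc] at hx
          · split_ifs at hl <;> omega)
      convert h3 using 3
      funext x
      split_ifs <;> omega
  simpa using key m le_rfl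

/-- Without crashes, the initial values are irrelevant for reachability. -/
theorem reach_inits {m C : ℕ} (hCt : C ≤ t) (hCn : C + 2 ≤ n) (hm : m ≤ C)
    (S : Fin n → Finset (Fin n)) (v w : Fin n → Value) :
    Reach t m (pattern m (fun _ => m) S, v) (pattern m (fun _ => m) S, w) := by
  have h0 : crashes m (fun _ : Fin n => m) = 0 := by simp [crashes]
  have hflip : ∀ (v v' : Fin n → Value) (j : Fin n), (∀ x ≠ j, v x = v' x) →
      Reach t m (pattern m (fun _ => m) S, v) (pattern m (fun _ => m) S, v') := by
    intro v v' j hv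
    have h1 := crashes_update_le m (fun _ => m) j 0
    have h1' : m = 0 → crashes m (Function.update (fun _ => m) j 0) ≤ 0 := fun h =>
      (crashes_update_le_of_ge (fun _ => m) j h.le).trans h0.le
    have hsil : ∀ v, Reach t m (pattern m (Function.update (fun _ => m) j 0)
        (Function.update S j ∅), v) (pattern m (fun _ => m) S, v) := by
      intro v
      have heq : pattern m (Function.update (Function.update (fun _ => m) j 0) j m)
          (Function.update S j ∅) = pattern m (fun _ => m) S :=
        pattern_congr fun x => by
          by_cases hx : x = j <;> simp [hx]
      rcases Nat.eq_zero_or_pos m with rfl | hpos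
      · rw [pattern_congr (c' := fun _ => 0) (S' := S)]
        · exact Reach.refl _
        · simp
      -- An agent silent from the start hides its initial value; this costs one crash plus one for
      -- each of the `m - 1` later rounds, hence `m ≤ C`.
      · have h2 := reach_uncrash (m := m) hCt hCn v (m - 1) 0 (Function.update (fun _ => m) j 0)
          (Function.update S j ∅) j (by omega) (fun x => by
            by_cases hx : x = j <;> simp [hx]) (by simp) (by omega)
        rwa [heq] at h2
    have h2 : crashes m (Function.update (fun _ => m) j 0) ≤ C := by
      rcases Nat.eq_zero_or_pos m with h | h
      · have := h1' h
        omega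
      · omega
    obtain ⟨l, hlj, hl⟩ := exists_ne_of_crashes (m := m)
      (c := Function.update (fun _ => m) j 0) (by omega) j
    have hF := pattern_mem_crash (Function.update S j ∅) (h2.trans hCt)
    refine ((hsil v).symm.trans ?_).trans (hsil v')
    refine reach_of_sameView hF hF (pattern_alive hl) (pattern_alive hl)
      (sameView_of_silent (b := 0) hv (fun h => absurd rfl h) (fun k hk _ x => ?_)
        (fun _ _ _ _ _ => rfl) hlj)
    rw [pattern_eq_false]
    simp only [Function.update_self, Finset.notMem_empty, false_and, and_false, or_false]
    omega
  have key : ∀ s : Finset (Fin n), Reach t m (pattern m (fun _ => m) S, v)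
      (pattern m (fun _ => m) S, fun i => if i ∈ s then w i else v i) := by
    intro s
    induction s using Finset.induction_on with
    | empty => simpa using Reach.refl _
    | insert j s _ ih =>
      exact ih.trans (hflip _ _ j fun x hx => by simp [hx])
  simpa using key Finset.univ

/-! ### From arbitrary failure patterns to arbitrary initial values. -/

/-- A scenario with low waste is indistinguishable from one given by crash times with low
waste. -/
theorem reach_pattern {F : FailurePattern n} (hF : F ∈ Crash n t) (v : Fin n → Value) {m D : ℕ}
    {p : Fin n} (hp : Alive F m p) (hD : est F m p ≤ D) :
    ∃ (c : Fin n → ℕ) (S : Fin n → Finset (Fin n)), crashes m c ≤ D + m ∧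
      (∀ a, a + 1 < m → (Finset.univ.filter fun x => c x ≤ a).card ≤ D + a + 2) ∧
      (∀ a, a + 1 < m → ∀ l, a < c l →
        (Finset.univ.filter fun x => c x < a ∨ (c x = a ∧ l ∉ S x)).card ≤ D + a + 1) ∧
      Reach t m (F, v) (pattern m c S, v) := by
  classical
  -- A crash in the last round that still reaches `p` is dropped, as `p` cannot see it. The
  -- remaining crashes are then all among the losses of `p` in that round.
  have hex : ∀ x, ∃ k, m ≤ k ∨ (F k x x = false ∧ (k + 1 = m → F k x p = false)) :=
    fun x => ⟨m, Or.inl le_rfl⟩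
  obtain ⟨c, hc⟩ : ∃ c : Fin n → ℕ, ∀ x,
      (m ≤ c x ∨ (F (c x) x x = false ∧ (c x + 1 = m → F (c x) x p = false))) ∧
      ∀ k < c x, k < m ∧ (F k x x = true ∨ (k + 1 = m ∧ F k x p = true)) := by
    refine ⟨fun x => Nat.find (hex x), fun x => ⟨Nat.find_spec (hex x), fun k hk => ?_⟩⟩
    have := Nat.find_min (hex x) hk
    push Not at this
    refine ⟨this.1, ?_⟩
    by_cases h : F k x x = true
    · exact Or.inl h
    · simpa using Or.inr (this.2 (by simpa using h))
  have hlost : ∀ k ≤ m, lost F k p ≤ D + k := by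
    intro k hk
    have h1 := lost_sub_le_est F k p
    have h2 : est F k p ≤ est F m p := est_mono F p hk
    omega
  have hafter : ∀ x k, c x < k → k < m → ∀ l, F k x l = false := by
    intro x k hk hkm l
    rcases (hc x).1 with h | h
    · omega
    · exact hF.2.1 _ x h.1 k hk l
  have hbefore : ∀ x k, k < c x → k + 1 < m → ∀ l, F k x l = true := by
    intro x k hk hkm l
    rcases ((hc x).2 k hk).2 with h | h
    · exact delivered_of_self hF h
    · omega
  have hcr : crashes m c ≤ D + m := by
    rcases Nat.eq_zero_or_pos m with rfl | hm
    · simp [crashes]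
    · obtain ⟨m, rfl⟩ : ∃ k, m = k + 1 := ⟨m - 1, by omega⟩
      refine le_trans (Finset.card_le_card fun x hx => ?_) (hlost (m + 1) le_rfl)
      simp only [Finset.mem_filter, Finset.mem_univ, true_and] at hx ⊢
      rcases Nat.lt_succ_iff_lt_or_eq.mp hx with h | h
      · exact hafter x m h m.lt_succ_self p
      · rcases (hc x).1 with h' | h'
        · omega
        · rw [← h]
          exact h'.2 (by omega)
  have hdead : ∀ a, a + 1 < m →
      (Finset.univ.filter fun x => c x ≤ a).card ≤ lost F (a + 2) p := by
    intro a ha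
    refine Finset.card_le_card fun x hx => ?_
    simp only [Finset.mem_filter, Finset.mem_univ, true_and] at hx ⊢
    exact hafter x _ (by omega) ha p
  refine ⟨c, fun x => Finset.univ.filter fun l => F (c x) x l = true, hcr, ?_, ?_, ?_⟩
  · intro a ha
    have := hlost (a + 2) ha
    have := hdead a ha
    omega
  · intro a ha l hl
    have hll : F a l l = true := hbefore l a hl ha l
    refine le_trans (Finset.card_le_card fun x hx => ?_) (?_ : lost F (a + 1) l ≤ _)
    · simp only [Finset.mem_filter, Finset.mem_univ, true_and] at hx ⊢
      rcases hx with hx | ⟨rfl, hx⟩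
      · exact hafter x a hx (by omega) l
      · simpa using hx
    · have h1 := lost_sub_le_est F (a + 1) l
      -- Either the estimate of `l` reaches `p` and is at most `D`, or `p` misses in the next round
      -- `l` itself besides all agents that `l` missed, which saves the one in `D + a + 2`.
      by_cases hlp : F (a + 1) l p = true
      · have h2 := est_le_of_delivered hlp
        have h3 : est F (a + 1 + 1) p ≤ est F m p := est_mono F p ha
        push_cast at h1
        omega
      · have h2 : lost F (a + 1) l + 1 ≤ lost F (a + 2) p := by
          have h3 : l ∉ Finset.univ.filter fun x => F a x l = false := by simp [hll]
          rw [lost, ← Finset.card_insert_of_notMem h3]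
          refine Finset.card_le_card fun x hx => ?_
          rw [Finset.mem_filter]
          refine ⟨Finset.mem_univ x, ?_⟩
          rcases Finset.mem_insert.mp hx with rfl | hx
          · simpa using hlp
          · exact hF.2.1 a x (hF.1 a x l (Finset.mem_filter.mp hx).2) _ a.lt_succ_self p
        have h3 := hlost (a + 2) ha
        omega
  · have hcp : m ≤ c p := by
      rcases (hc p).1 with h | h
      · exact h
      · by_contra hlt
        have := hp (c p) (by omega)
        simp [this] at h
    have hct : crashes m c ≤ t := by
      refine le_trans (Finset.card_le_card fun x hx => ?_) (card_dead_le hF m)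
      have hx' : c x < m := (Finset.mem_filter.mp hx).2
      rw [mem_dead]
      intro h
      have h1 := h (c x) hx'
      rcases (hc x).1 with h2 | h2
      · omega
      · simp [h1] at h2
    refine reach_of_sameView hF (pattern_mem_crash _ hct) hp (pattern_alive hcp)
      -- The patterns agree before the last round and, in that round, on what `p` receives.
      (sameView_of_hidden (Nat.zero_le m) (fun k => {x | k = m ∧ x ≠ p})
        (fun _ _ => sameView_zero rfl) (fun k _ hk _ _ h => hk.ne h.1) ?_
        (fun k _ hk _ _ _ _ h => hk.ne h.1) (fun h => h.2 rfl))
    intro k _ hk i hi j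
    have hip : k + 1 = m → i = p := fun h => by_contra fun h' => hi ⟨h, h'⟩
    rw [Bool.eq_iff_iff, pattern_eq_true]
    rcases lt_trichotomy k (c j) with h | rfl | h
    · refine iff_of_true ?_ (Or.inr (Or.inl h))
      by_cases hkm : k + 1 < m
      · exact hbefore j k h hkm i
      · obtain rfl := hip (by omega)
        rcases ((hc j).2 k h).2 with h' | h'
        · exact delivered_of_self hF h'
        · exact h'.2
    · have hjj : F (c j) j j = false := by
        rcases (hc j).1 with h' | h'
        · omega
        · exact h'.1
      have hij : F (c j) j i = true → i ≠ j := by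
        rintro h' rfl
        simp [h'] at hjj
      simp only [Finset.mem_filter, Finset.mem_univ, true_and, lt_irrefl, false_or, not_le.mpr hk]
      exact ⟨fun h' => ⟨h', hij h'⟩, And.left⟩
    · refine iff_of_false ?_ (by omega)
      rw [hafter j k h hk i]
      exact Bool.false_ne_true

theorem reach_of_waste_lt {F : FailurePattern n} (hF : F ∈ Crash n t) {m : ℕ} {p : Fin n}
    (hp : Alive F m p) (h : (m : ℤ) < min ((t : ℤ) + 1) ((n : ℤ) - 1) - est F m p)
    (v w : Fin n → Value) : ∃ F', Reach t m (F, v) (F', w) := by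
  obtain ⟨D, hD⟩ := Int.eq_ofNat_of_zero_le (est_nonneg F m p)
  obtain ⟨c, S, h0, h1, h2, h3⟩ := reach_pattern hF v hp hD.le
  -- The strict bound by `min {t + 1, n - 1}` over the integers; it forces `n ≥ 2`, so `n - 2` is
  -- not truncated.
  have hC : D + m ≤ min t (n - 2) := by omega
  have hCn : min t (n - 2) + 2 ≤ n := by omega
  exact ⟨_, (h3.trans (reach_crash_free (min_le_left _ _) hCn hC v h0 h1 h2)).trans
    (reach_inits (min_le_left _ _) hCn (by omega) S v w)⟩

end SendWaste

/-! ### Common knowledge -/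

/-- The induction rule for common knowledge: `Q` spreads to every point that a nonfailed agent
considers possible. -/
theorem commonKnowledge_of_invariant {n : ℕ} {E : InfoExchange n} {R : Set (Run E)}
    {φ : PointProp E} (Q : PointProp E) (hφ : ∀ r ∈ R, ∀ m, Q r m → φ r m)
    (hQ : ∀ r ∈ R, ∀ m, Q r m → ∀ i ∈ nonfailed E r m, ∀ r' ∈ R, ∀ m',
      (r m).loc i = (r' m').loc i → Q r' m')
    {r : Run E} (hr : r ∈ R) {m : ℕ} (h : Q r m) : CommonKnowledge R φ r m := by
  have key : ∀ k, ∀ r ∈ R, ∀ m, Q r m → ((EveryoneKnows R)^[k] φ) r m := by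
    intro k
    induction k with
    | zero => exact hφ
    | succ k ih =>
      intro r hr m h
      rw [Function.iterate_succ_apply']
      exact fun i hi r' hr' m' hl => ih r' hr' m' (hQ r hr m h i hi r' hr' m' hl)
  exact fun k _ => key k r hr m h

theorem CommonKnowledge.of_loc_eq {n : ℕ} {E : InfoExchange n} {R : Set (Run E)}
    {φ : PointProp E} {r r' : Run E} {m m' : ℕ} (h : CommonKnowledge R φ r m) {i : Fin n}
    (hi : i ∈ nonfailed E r m) (hr' : r' ∈ R) (hl : (r m).loc i = (r' m').loc i) :
    CommonKnowledge R φ r' m' := by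
  intro k _
  have := h (k + 1) (Nat.le_add_left 1 k)
  rw [Function.iterate_succ_apply'] at this
  exact this i hi r' hr' m' hl

theorem CommonKnowledge.holds {n : ℕ} {E : InfoExchange n} {R : Set (Run E)}
    {φ : PointProp E} {r : Run E} (hr : r ∈ R) {m : ℕ} (h : CommonKnowledge R φ r m) {i : Fin n}
    (hi : i ∈ nonfailed E r m) : φ r m :=
  h 1 le_rfl i hi r hr m rfl

/-- If a decision is taken in a run of an SBA protocol, then it is common knowledge that some
agent has the value decided. -/
theorem IsSBA.commonKnowledge {n t : ℕ} {E : InfoExchange n} {P : DecisionProtocol E}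
    (hP : IsSBA E t P) {r : Run E} (hr : r ∈ system E t P) {m : ℕ} {i : Fin n}
    (hi : i ∈ nonfailed E r m) {v : Value} (hv : P i ((r m).loc i) = Action.decide v) :
    CommonKnowledge (system E t P) (existsInit E v) r m := by
  refine commonKnowledge_of_invariant
    (fun r m => ∃ i ∈ nonfailed E r m, P i ((r m).loc i) = Action.decide v)
    ?_ ?_ hr ⟨i, hi, hv⟩
  · rintro r hr m ⟨i, hi, hv⟩
    exact hP.validity r hr m i hi v hv
  · rintro r hr m ⟨i, hi, hv⟩ j hj r' hr' m' hl
    obtain ⟨w, hw⟩ := hP.simultaneity r hr m i hi j hj ⟨v, hv⟩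
    obtain rfl := hP.agreement r hr m m i hi j hj v w hv hw
    rw [mem_nonfailed, hl] at hj
    exact ⟨j, mem_nonfailed.mpr hj, hl ▸ hw⟩

/-! ### Common knowledge in SendWaste and optimality of `pSend`. -/

namespace SendWaste

variable {n t : ℕ}

/-- Common knowledge itself passes along each link of the chain, and at the end it implies truth
because the last scenario has a survivor. -/
theorem Reach.commonKnowledge {P : DecisionProtocol (sendWaste n)} {x : Value} {m : ℕ}
    {a b : Scenario n} (h : Reach t m a b) {r : Run (sendWaste n)}
    (hr : r ∈ system (sendWaste n) t P) {i : Fin n} (hi : Alive (r 0).env m i)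
    (ha : a = ((r 0).env, inits r))
    (hC : CommonKnowledge (system (sendWaste n) t P) (existsInit (sendWaste n) x) r m) :
    ∃ j, b.2 j = x := by
  induction h using Relation.ReflTransGen.head_induction_on generalizing r i with
  | refl =>
    subst ha
    exact hC.holds hr ((mem_nonfailed_iff hr).mpr hi)
  | @head a c hac _ ih =>
    subst ha
    obtain ⟨-, hc, j, hj, hj', hs⟩ := hac
    have hr' := runOf_mem hc c.2 P
    refine ih hr' (i := j) hj' (by rw [inits_runOf]; rfl) ?_
    exact hC.of_loc_eq ((mem_nonfailed_iff hr).mpr hj) hr' ((loc_eq_state hr m j).trans hs)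

theorem pSend_active_eq_decide_iff {i : Fin n} {W : Finset Value} {h m : ℕ} {d : ℤ}
    {x y : Value} : pSend n t i (.active W h d m x) = Action.decide y ↔
      (m : ℤ) ≥ min ((t : ℤ) + 1) ((n : ℤ) - 1) - d ∧ ∃ hW : W.Nonempty, W.min' hW = y := by
  unfold pSend
  dsimp only
  split_ifs with h1 h2
  · simp [h1, h2]
  · simp [h2]
  · simp [h1]

theorem pSend_state_eq_decide_iff {F : FailurePattern n} {v : Fin n → Value} {i : Fin n} {m : ℕ}
    (hi : Alive F m i) {y : Value} : pSend n t i (state F v m i) = Action.decide y ↔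
      (m : ℤ) ≥ min ((t : ℤ) + 1) ((n : ℤ) - 1) - est F m i ∧
        ∃ hW : (vals F v m i).Nonempty, (vals F v m i).min' hW = y := by
  rw [state_of_alive hi]
  exact pSend_active_eq_decide_iff

theorem exists_pSend_decide {F : FailurePattern n} {v : Fin n → Value} {i : Fin n} {m : ℕ}
    (hi : Alive F m i) (h : (m : ℤ) ≥ min ((t : ℤ) + 1) ((n : ℤ) - 1) - est F m i) :
    ∃ y, pSend n t i (state F v m i) = Action.decide y :=
  ⟨_, (pSend_state_eq_decide_iff hi).mpr ⟨h, ⟨_, mem_vals_of_alive v hi⟩, rfl⟩⟩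

/-- A nonfailed agent whose own waste estimate allows a decision makes some value common
knowledge. -/
theorem exists_commonKnowledge {P : DecisionProtocol (sendWaste n)} {r : Run (sendWaste n)}
    (hr : r ∈ system (sendWaste n) t P) {m : ℕ} {i : Fin n} (hi : Alive (r 0).env m i)
    (h : (m : ℤ) ≥ min ((t : ℤ) + 1) ((n : ℤ) - 1) - est (r 0).env m i) :
    ∃ x, CommonKnowledge (system (sendWaste n) t P) (existsInit (sendWaste n) x) r m := by
  obtain ⟨x, hx⟩ := exists_pSend_decide (v := inits r) hi h
  -- The invariant is a decision by `pSend`, although the system is that of an arbitrary `P`; states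
  -- do not depend on `P`.
  refine ⟨x, commonKnowledge_of_invariant (fun r m => ∃ i, Alive (r 0).env m i ∧
    pSend n t i (state (r 0).env (inits r) m i) = Action.decide x) ?_ ?_ hr ⟨i, hi, hx⟩⟩
  · rintro r hr m ⟨i, hi, hx⟩
    obtain ⟨-, hW, hx⟩ := (pSend_state_eq_decide_iff hi).mp hx
    have : x ∈ vals (r 0).env (inits r) m i := hx ▸ Finset.min'_mem _ hW
    exact exists_init_of_mem_vals this
  · rintro r hr m ⟨i, hi, hx⟩ j hj r' hr' m' hl
    have hj' := (mem_nonfailed_iff hr).mp hj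
    obtain ⟨hm, hx⟩ := (pSend_state_eq_decide_iff hi).mp hx
    obtain ⟨hW, hm'⟩ := agreement_of_waste hr.env_mem (inits r) hi hj' hm
    refine ⟨j, ?_, ?_⟩
    · rw [mem_nonfailed, hl] at hj
      exact (mem_nonfailed_iff hr').mp (mem_nonfailed.mpr hj)
    · rw [← loc_eq_state hr' m' j, ← hl, loc_eq_state hr m j]
      rw [hW] at hx
      exact (pSend_state_eq_decide_iff hj').mpr ⟨hm', hx⟩

theorem waste_of_commonKnowledge {P : DecisionProtocol (sendWaste n)} {r : Run (sendWaste n)}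
    (hr : r ∈ system (sendWaste n) t P) {m : ℕ} {i : Fin n} (hi : Alive (r 0).env m i) {x : Value}
    (h : CommonKnowledge (system (sendWaste n) t P) (existsInit (sendWaste n) x) r m) :
    (m : ℤ) ≥ min ((t : ℤ) + 1) ((n : ℤ) - 1) - est (r 0).env m i := by
  by_contra hlt
  -- In `Fin 2`, `x + 1` is the other value, so nobody has `x` at the end of the chain.
  obtain ⟨F', hF'⟩ := reach_of_waste_lt hr.env_mem hi (not_le.mp hlt) (inits r) fun _ => x + 1
  obtain ⟨_, hx⟩ := hF'.commonKnowledge hr hi rfl h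
  have hx' : x + 1 = x := hx
  fin_cases x <;> exact absurd hx' (by decide)

theorem wasteEstimate_loc {P : DecisionProtocol (sendWaste n)} {r : Run (sendWaste n)}
    (hr : r ∈ system (sendWaste n) t P) {m : ℕ} {i : Fin n} (hi : Alive (r 0).env m i) :
    wasteEstimate ((r m).loc i) = est (r 0).env m i := by
  rw [loc_eq_state hr m i, state_of_alive hi]
  rfl

theorem commonKnowledge_iff {P : DecisionProtocol (sendWaste n)} {r : Run (sendWaste n)}
    (hr : r ∈ system (sendWaste n) t P) {m : ℕ} (hne : (nonfailed (sendWaste n) r m).Nonempty) :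
    (∃ x, CommonKnowledge (system (sendWaste n) t P) (existsInit (sendWaste n) x) r m) ↔
      (m : ℤ) ≥ min ((t : ℤ) + 1) ((n : ℤ) - 1) - maxWaste r m hne := by
  obtain ⟨j, hj, hmax⟩ := Finset.exists_mem_eq_sup' hne fun i => wasteEstimate ((r m).loc i)
  have hj' := (mem_nonfailed_iff hr).mp hj
  rw [maxWaste, hmax, wasteEstimate_loc hr hj']
  exact ⟨fun ⟨x, hx⟩ => waste_of_commonKnowledge hr hj' hx, exists_commonKnowledge hr hj'⟩

theorem pSend_agreement {r : Run (sendWaste n)} (hr : r ∈ system (sendWaste n) t (pSend n t))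
    {m m' : ℕ} (hmm : m ≤ m') {i j : Fin n} (hi : i ∈ nonfailed (sendWaste n) r m)
    (hj : j ∈ nonfailed (sendWaste n) r m') {v v' : Value}
    (hv : pSend n t i ((r m).loc i) = Action.decide v)
    (hv' : pSend n t j ((r m').loc j) = Action.decide v') : v = v' := by
  rw [mem_nonfailed_iff hr] at hi hj
  rw [loc_eq_state hr] at hv hv'
  obtain ⟨hm, hW, hv⟩ := (pSend_state_eq_decide_iff hi).mp hv
  obtain ⟨-, hW', hv'⟩ := (pSend_state_eq_decide_iff hj).mp hv'
  have h := vals_eq_of_common hr.env_mem hmm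
    (fun x hx => (agreement_of_waste hr.env_mem (inits r) hi hx hm).1.symm) hj
  rw [← hv, ← hv']
  simp only [h]

theorem pSend_isSBA : IsSBA (sendWaste n) t (pSend n t) where
  agreement r hr m m' i hi j hj v v' hv hv' := by
    rcases le_total m m' with h | h
    · exact pSend_agreement hr h hi hj hv hv'
    · exact (pSend_agreement hr h hj hi hv' hv).symm
  validity r hr m i hi v hv := by
    rw [mem_nonfailed_iff hr] at hi
    rw [loc_eq_state hr] at hv
    obtain ⟨-, hW, hv⟩ := (pSend_state_eq_decide_iff hi).mp hv
    have : v ∈ vals (r 0).env (inits r) m i := hv ▸ Finset.min'_mem _ hW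
    exact exists_init_of_mem_vals this
  simultaneity r hr m i hi j hj h := by
    rw [mem_nonfailed_iff hr] at hi hj
    rw [loc_eq_state hr] at h ⊢
    obtain ⟨v, hv⟩ := h
    have hm := ((pSend_state_eq_decide_iff hi).mp hv).1
    exact exists_pSend_decide hj (agreement_of_waste hr.env_mem (inits r) hi hj hm).2

/-- A decision under `P'` makes a value common knowledge, hence every survivor passes the threshold
with its own estimate, and that estimate is the same in the corresponding run. -/
theorem pSend_isOptimumSBA : IsOptimumSBA (sendWaste n) t (pSend n t) := by
  refine ⟨pSend_isSBA, ?_⟩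
  rintro P' hP' r hr r' hr' ⟨henv, hinit⟩ m i hi ⟨v, hv⟩
  have hi' := (mem_nonfailed_iff hr).mp hi
  have hm := waste_of_commonKnowledge hr hi' (hP'.commonKnowledge hr hi hv)
  rw [loc_eq_state hr' m i]
  rw [henv] at hi' hm
  exact exists_pSend_decide hi' hm

theorem pSend_terminates : Terminates (sendWaste n) t (pSend n t) := by
  intro r hr i
  -- Estimates are nonnegative and the threshold is at most `n - 1`, so time `n` is late enough.
  refine ⟨n, or_iff_not_imp_left.mpr fun hi => ?_⟩
  have hi' := (mem_nonfailed_iff hr).mp (not_not.mp hi)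
  rw [loc_eq_state hr]
  refine exists_pSend_decide hi' ?_
  have := est_nonneg (r 0).env n i
  omega

end SendWaste

end SBA

theorem mainTheorem8 (n t : ℕ) (ht : t < n) :
    (∀ P : SBA.DecisionProtocol (SBA.sendWaste n),
      ∀ r ∈ SBA.system (SBA.sendWaste n) t P, ∀ (m : ℕ) (i : Fin n)
        (hi : i ∈ SBA.nonfailed (SBA.sendWaste n) r m),
        (∃ v : SBA.Value,
          SBA.CommonKnowledge (SBA.system (SBA.sendWaste n) t P)
            (SBA.existsInit (SBA.sendWaste n) v) r m) ↔
        (m : ℤ) ≥ min ((t : ℤ) + 1) ((n : ℤ) - 1) - SBA.maxWaste r m ⟨i, hi⟩) ∧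
    SBA.IsOptimumSBA (SBA.sendWaste n) t (SBA.pSend n t) ∧
    SBA.Terminates (SBA.sendWaste n) t (SBA.pSend n t) :=
  ⟨fun _ _ hr _ i hi => SBA.SendWaste.commonKnowledge_iff hr ⟨i, hi⟩,
    SBA.SendWaste.pSend_isOptimumSBA, SBA.SendWaste.pSend_terminates⟩
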